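/- Let $X$ be a complex Banach space with dual $X'$, let $-\mathrm{i}A$ be the generator of a $C_0$-group $(U_s)_{s\in\mathbb{R}}$ on $X$, let $\omega\ge 0$, and let $v:\mathbb{R}\to[1,\infty)$ be strongly admissible, i.e. $v$ is measurable, $\sup_{s,t\in\mathbb{R}}\frac{v(s+t)}{v(s)+v(t)}<\infty$, and $\frac1v\in L^2(\mathbb{R})$. Let $L^2_{v,\omega}(\mathbb{R})$ be the space of all $g\in L^2(\mathbb{R})$ with $\|g\|_{L^2_{v,\omega}}:=\|\mathrm{e}^{\omega|s|}v\,g\|_{L^2}<\infty$. Let $\mathrm{W}^2_v(\mathrm{St}_\omega)$ be the algebra (under pointwise multiplication) of all functions $f=\widehat g$, $g\in L^2_{v,\omega}(\mathbb{R})$, on the closed strip $\overline{\mathrm{St}}_\omega=\{z\in\mathbb{C}: |\operatorname{Im}z|\le\omega\}$, where $\widehat g(z)=\int_{\mathbb{R}}\mathrm{e}^{-\mathrm{i}sz}g(s)\,\mathrm{d}s$, with norm $\|\widehat g\|:=\|g\|_{L^2_{v,\omega}}$; for $f=\widehat g$ write $f^\vee:=g$, which is determined by $f$ almost everywhere. The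 operator $A$ is said to have a bounded $\mathrm{W}^2_v(\mathrm{St}_\omega)$-calculus if there is a bounded algebra homomorphism $\Psi:\mathrm{W}^2_v(\mathrm{St}_\omega)\to\mathcal{L}(X)$ such that $\Psi\big((\lambda-z)^{-1}\big)=(\lambda-A)^{-1}$ for some $\lambda\in\mathbb{C}$ with $|\operatorname{Im}\lambda|>\omega$; one then writes $f(A):=\Psi(f)$. Then the following statements are equivalent: (i) For all $x\in X$ and $x'\in X'$ the function $s\mapsto\frac{\mathrm{e}^{-\omega|s|}}{v(s)}\langle U_sx,x'\rangle$ belongs to $L^2(\mathbb{R})$. (ii) $A$ has a bounded $\mathrm{W}^2_v(\mathrm{St}_\omega)$-calculus. In that case, every such $\Psi$ satisfies $\Psi\big((\lambda-z)^{-1}\big)=(\lambda-A)^{-1}$ for all $\lambda\in\mathbb{C}$ with $|\operatorname{Im}\lambda|>\omega$, and $$\langle f(A)x,x'\rangle=\int_{\mathbb{R}}f^\vee(s)\,\langle U_sx,x'\rangle\,\mathrm{d}s$$ for all $f\in \mathrm{W}^2_v(\mathrm{St}_\omega)$, $x\in X$, $x'\in X'$, the integral being absolutely convergent. -/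

import Mathlib

open MeasureTheory
open scoped ENNReal Convolution

namespace SobolevCalculus

/-! ### Weights and weighted `L²`-spaces -/

/-- A measurable function `v : ℝ → [1, ∞)` is strongly admissible if
`sup_{s,t} v (s + t) / (v s + v t) < ∞` and `1 / v ∈ L²(ℝ)`. -/
structure StronglyAdmissible (v : ℝ → ℝ) : Prop where
  measurable : Measurable v
  one_le : ∀ s, 1 ≤ v s
  bddAbove : BddAbove (Set.range fun p : ℝ × ℝ => v (p.1 + p.2) / (v p.1 + v p.2))
  memLp_inv : MemLp (fun s => (v s)⁻¹) 2 volume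

/-- The function `s ↦ exp (ω |s|) v(s) g(s)`. -/
noncomputable def weighted (v : ℝ → ℝ) (ω : ℝ) (g : ℝ → ℂ) (s : ℝ) : ℂ :=
  ((Real.exp (ω * |s|) * v s : ℝ) : ℂ) * g s

/-- `g ∈ L²_{v,ω}(ℝ)`, that is, `g ∈ L²(ℝ)` and `exp (ω |s|) v g ∈ L²(ℝ)`. -/
def MemWeightedL2 (v : ℝ → ℝ) (ω : ℝ) (g : ℝ → ℂ) : Prop :=
  MemLp g 2 volume ∧ MemLp (weighted v ω g) 2 volume

/-- The norm of `L²_{v,ω}(ℝ)`, namely `‖exp (ω |s|) v g‖_{L²}`. -/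
noncomputable def weightedL2Norm (v : ℝ → ℝ) (ω : ℝ) (g : ℝ → ℂ) : ℝ :=
  (eLpNorm (weighted v ω g) 2 volume).toReal

/-! ### The Fourier transform on the closed strip and the Sobolev algebra -/

/-- The closed horizontal strip `{z | |Im z| ≤ ω}` (the real line for `ω = 0`). -/
abbrev ClosedStrip (ω : ℝ) : Type := {z : ℂ // |z.im| ≤ ω}

/-- The Fourier transform `ĝ(z) = ∫ exp (-i s z) g(s) ds` as a function on the closed strip. -/
noncomputable def stripFourier (ω : ℝ) (g : ℝ → ℂ) (z : ClosedStrip ω) : ℂ :=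
  ∫ s : ℝ, Complex.exp (-Complex.I * s * (z : ℂ)) * g s

/-- `g = f^∨` for a function `f` in the Sobolev space, that is,
`g ∈ L²_{v,ω}(ℝ)` and `f = ĝ`. -/
def IsInvFourier (v : ℝ → ℝ) (ω : ℝ) (f : ClosedStrip ω → ℂ) (g : ℝ → ℂ) : Prop :=
  MemWeightedL2 v ω g ∧ f = stripFourier ω g

variable {v : ℝ → ℝ} {ω : ℝ} {g h : ℝ → ℂ}

theorem StronglyAdmissible.pos (hv : StronglyAdmissible v) (s : ℝ) : 0 < v s :=
  lt_of_lt_of_le one_pos (hv.one_le s)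

theorem MemWeightedL2.add (hg : MemWeightedL2 v ω g) (hh : MemWeightedL2 v ω h) :
    MemWeightedL2 v ω (g + h) := by
  refine ⟨hg.1.add hh.1, ?_⟩
  have : weighted v ω (g + h) = weighted v ω g + weighted v ω h := by
    funext s; simp [weighted, mul_add]
  rw [this]; exact hg.2.add hh.2

theorem MemWeightedL2.smul (c : ℂ) (hg : MemWeightedL2 v ω g) :
    MemWeightedL2 v ω (c • g) := by
  refine ⟨hg.1.const_smul c, ?_⟩
  have : weighted v ω (c • g) = c • weighted v ω g := by
    funext s; simp only [weighted, Pi.smul_apply, smul_eq_mul]; ring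
  rw [this]; exact hg.2.const_smul c

theorem memWeightedL2_zero : MemWeightedL2 v ω 0 := by
  refine ⟨MemLp.zero, ?_⟩
  have : weighted v ω 0 = 0 := by funext s; simp [weighted]
  rw [this]; exact MemLp.zero

/-- `exp (ω |s|) g` is integrable for `g ∈ L²_{v,ω}(ℝ)`. -/
theorem MemWeightedL2.integrable_exp (hv : StronglyAdmissible v) (hg : MemWeightedL2 v ω g) :
    Integrable (fun s => ((Real.exp (ω * |s|) : ℝ) : ℂ) * g s) := by
  have h1 : MemLp (fun s => (((v s)⁻¹ : ℝ) : ℂ)) 2 volume := hv.memLp_inv.ofReal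
  have h2 := h1.integrable_mul hg.2
  refine h2.congr (Filter.Eventually.of_forall fun s => ?_)
  have : ((v s : ℝ) : ℂ) ≠ 0 := by exact_mod_cast (hv.pos s).ne'
  simp only [weighted, Pi.mul_apply]
  push_cast
  field_simp

theorem norm_exp_strip (z : ClosedStrip ω) (s : ℝ) :
    ‖Complex.exp (-Complex.I * s * (z : ℂ))‖ ≤ Real.exp (ω * |s|) := by
  rw [Complex.norm_exp]
  refine Real.exp_le_exp.2 ?_
  have : (-Complex.I * s * (z : ℂ)).re = s * (z : ℂ).im := by simp
  rw [this]
  calc s * (z : ℂ).im ≤ |s * (z : ℂ).im| := le_abs_self _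
    _ = |(z : ℂ).im| * |s| := by rw [abs_mul, mul_comm]
    _ ≤ ω * |s| := mul_le_mul_of_nonneg_right z.2 (abs_nonneg s)

/-- The integral defining `ĝ(z)` converges absolutely on the closed strip. -/
theorem MemWeightedL2.integrable_kernel (hv : StronglyAdmissible v) (hg : MemWeightedL2 v ω g)
    (z : ClosedStrip ω) :
    Integrable (fun s : ℝ => Complex.exp (-Complex.I * s * (z : ℂ)) * g s) := by
  refine (hg.integrable_exp hv).mono ?_ (Filter.Eventually.of_forall fun s => ?_)
  · exact (Continuous.aestronglyMeasurable (by fun_prop)).mul hg.1.1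
  · rw [norm_mul, norm_mul, Complex.norm_real, Real.norm_of_nonneg (Real.exp_pos _).le]
    exact mul_le_mul_of_nonneg_right (norm_exp_strip z s) (norm_nonneg _)

/-- The function `g = f^∨` is determined by `f` almost everywhere. -/
theorem IsInvFourier.ae_eq (hv : StronglyAdmissible v) (hω : 0 ≤ ω) {f : ClosedStrip ω → ℂ}
    (hg : IsInvFourier v ω f g) (hh : IsInvFourier v ω f h) : g =ᵐ[volume] h := by
  have hz : ∀ x : ℝ, |((x : ℝ) : ℂ).im| ≤ ω := fun x => by simpa using hω
  have hgi : Integrable g := by simpa using hg.1.integrable_kernel hv ⟨0, by simpa using hω⟩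
  have hhi : Integrable h := by simpa using hh.1.integrable_kernel hv ⟨0, by simpa using hω⟩
  have hki : Integrable (g - h) := hgi.sub hhi
  have hF : ∀ ξ : ℝ, FourierTransform.fourier (g - h) ξ = 0 := by
    intro ξ
    have h1 := congrFun (hg.2.symm.trans hh.2) ⟨((2 * Real.pi * ξ : ℝ) : ℂ), hz _⟩
    simp only [stripFourier] at h1
    rw [← sub_eq_zero, ← integral_sub (hg.1.integrable_kernel hv ⟨_, hz _⟩)
      (hh.1.integrable_kernel hv ⟨_, hz _⟩)] at h1
    rw [Real.fourier_real_eq_integral_exp_smul, ← h1]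
    refine integral_congr_ae (Filter.Eventually.of_forall fun s => ?_)
    simp only [Pi.sub_apply, smul_eq_mul, ← mul_sub]
    congr 2
    push_cast
    ring
  have hae : ∀ᵐ s : ℝ, (g - h) s = 0 := by
    refine ae_eq_zero_of_integral_contDiff_smul_eq_zero hki.locallyIntegrable ?_
    intro ψ hψ hψc
    have hc : HasCompactSupport (fun x => ((ψ x : ℝ) : ℂ)) :=
      hψc.comp_left (g := fun r : ℝ => (r : ℂ)) (by simp)
    let φ : SchwartzMap ℝ ℂ := hc.toSchwartzMap (Complex.ofRealCLM.contDiff.comp hψ)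
    let χ : SchwartzMap ℝ ℂ := FourierTransformInv.fourierInv φ
    have hχ : FourierTransform.fourier χ = φ := FourierTransform.fourier_fourierInv_eq φ
    have key := VectorFourier.integral_bilin_fourierIntegral_eq_flip (ContinuousLinearMap.mul ℂ ℂ)
      (L := innerₗ ℝ) Real.continuous_fourierChar continuous_inner hki (χ.integrable (μ := volume))
    have e1 : ∀ ξ : ℝ, VectorFourier.fourierIntegral Real.fourierChar volume (innerₗ ℝ) (g - h) ξ
        = 0 := hF
    have e2 : ∀ x : ℝ, VectorFourier.fourierIntegral Real.fourierChar volume (innerₗ ℝ).flip χ x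
        = φ x := fun x => by
      rw [flip_innerₗ, ← hχ]; rfl
    simp only [e1, e2, ContinuousLinearMap.mul_apply', zero_mul, integral_zero] at key
    rw [key]
    refine integral_congr_ae (Filter.Eventually.of_forall fun s => ?_)
    change ψ s • (g - h) s = (g - h) s * ((ψ s : ℝ) : ℂ)
    rw [Complex.real_smul, mul_comm]
  filter_upwards [hae] with s hs
  exact sub_eq_zero.1 hs

/-- Young's inequality `‖F * H‖_2 ≤ ‖F‖_1 ‖H‖_2` for non-negative functions, in squared form. -/
theorem lintegral_conv_sq_le {F H : ℝ → ℝ≥0∞} (hF : AEMeasurable F) (hH : AEMeasurable H) :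
    ∫⁻ s, (∫⁻ t, F t * H (s - t)) ^ (2 : ℝ) ≤ (∫⁻ t, F t) ^ (2 : ℝ) * ∫⁻ s, H s ^ (2 : ℝ) := by
  have hHs : ∀ s : ℝ, AEMeasurable (fun t => H (s - t)) := fun s =>
    hH.comp_quasiMeasurePreserving (quasiMeasurePreserving_sub_left volume s)
  have key : ∀ s : ℝ, (∫⁻ t, F t * H (s - t)) ^ (2 : ℝ) ≤
      (∫⁻ t, F t) * ∫⁻ t, F t * H (s - t) ^ (2 : ℝ) := by
    intro s
    have hol := ENNReal.lintegral_mul_le_Lp_mul_Lq volume Real.HolderConjugate.two_two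
      (f := fun t => F t ^ (1 / 2 : ℝ)) (g := fun t => F t ^ (1 / 2 : ℝ) * H (s - t))
      (hF.pow_const _) ((hF.pow_const _).mul (hHs s))
    have hsq : ∀ a : ℝ≥0∞, (a ^ (1 / 2 : ℝ)) ^ (2 : ℝ) = a := fun a => by
      rw [← ENNReal.rpow_mul]; norm_num
    have h1 : ∀ t, ((fun t => F t ^ (1 / 2 : ℝ)) * fun t => F t ^ (1 / 2 : ℝ) * H (s - t)) t
        = F t * H (s - t) := by
      intro t
      have : F t ^ (1 / 2 : ℝ) * F t ^ (1 / 2 : ℝ) = F t := by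
        rw [← ENNReal.rpow_add_of_nonneg _ _ (by norm_num) (by norm_num)]; norm_num
      simp only [Pi.mul_apply]
      rw [← mul_assoc, this]
    simp only [h1, ENNReal.mul_rpow_of_nonneg _ _ (zero_le_two (α := ℝ)), hsq] at hol
    calc (∫⁻ t, F t * H (s - t)) ^ (2 : ℝ)
        ≤ ((∫⁻ t, F t) ^ (1 / 2 : ℝ) *
            (∫⁻ t, F t * H (s - t) ^ (2 : ℝ)) ^ (1 / 2 : ℝ)) ^ (2 : ℝ) :=
          ENNReal.rpow_le_rpow hol zero_le_two
      _ = _ := by rw [ENNReal.mul_rpow_of_nonneg _ _ zero_le_two, hsq, hsq]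
  have hprod : AEMeasurable (fun p : ℝ × ℝ => F p.2 * H (p.1 - p.2) ^ (2 : ℝ))
      (volume.prod volume) :=
    (hF.comp_quasiMeasurePreserving Measure.quasiMeasurePreserving_snd).mul
      ((hH.comp_quasiMeasurePreserving
        (quasiMeasurePreserving_sub_of_right_invariant volume volume)).pow_const _)
  calc ∫⁻ s, (∫⁻ t, F t * H (s - t)) ^ (2 : ℝ)
      ≤ ∫⁻ s, (∫⁻ t, F t) * ∫⁻ t, F t * H (s - t) ^ (2 : ℝ) := lintegral_mono key
    _ = (∫⁻ t, F t) * ∫⁻ s, ∫⁻ t, F t * H (s - t) ^ (2 : ℝ) :=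
        lintegral_const_mul'' _ hprod.lintegral_prod_right'
    _ = (∫⁻ t, F t) * ∫⁻ t, ∫⁻ s, F t * H (s - t) ^ (2 : ℝ) := by
        rw [lintegral_lintegral_swap hprod]
    _ = (∫⁻ t, F t) * ∫⁻ t, F t * ∫⁻ s, H s ^ (2 : ℝ) := by
        congr 1
        refine lintegral_congr fun t => ?_
        have hHt : AEMeasurable (fun s => H (s - t)) := hH.comp_quasiMeasurePreserving
          (measurePreserving_sub_right volume t).quasiMeasurePreserving
        rw [lintegral_const_mul'' _ (hHt.pow_const _), lintegral_sub_right_eq_self (fun s => H s ^ (2 : ℝ)) t]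
    _ = _ := by
        rw [lintegral_mul_const'' _ hF, ← mul_assoc]
        congr 1
        rw [ENNReal.rpow_two, sq]

/-- `L²_{v,ω}(ℝ)` is closed under convolution. -/
theorem MemWeightedL2.convolution (hv : StronglyAdmissible v) (hω : 0 ≤ ω)
    (hg : MemWeightedL2 v ω g) (hh : MemWeightedL2 v ω h) :
    MemWeightedL2 v ω (g ⋆[ContinuousLinearMap.mul ℝ ℂ, volume] h) := by
  have hconvint : AEStronglyMeasurable (g ⋆[ContinuousLinearMap.mul ℝ ℂ, volume] h) volume := by
    have hg0 : Integrable g := by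
      simpa using hg.integrable_kernel hv ⟨0, by simpa using hω⟩
    have hh0 : Integrable h := by
      simpa using hh.integrable_kernel hv ⟨0, by simpa using hω⟩
    exact (hg0.integrable_convolution _ hh0).aestronglyMeasurable
  obtain ⟨M, hM⟩ := hv.bddAbove
  have hM' : ∀ s t, v (s + t) ≤ M * (v s + v t) := fun s t => by
    have := hM (Set.mem_range_self (s, t))
    exact (div_le_iff₀ (add_pos (hv.pos s) (hv.pos t))).1 this
  have hM0 : 0 ≤ M := by
    have h0 := hM' 0 0
    have h1 := hv.pos 0
    have h2 := hv.pos (0 + 0)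
    nlinarith
  let E : ℝ → ℝ := fun s => Real.exp (ω * |s|)
  have hE : ∀ s t, E s ≤ E t * E (s - t) := fun s t => by
    simp only [E]
    rw [← Real.exp_add, ← mul_add]
    refine Real.exp_le_exp.2 (mul_le_mul_of_nonneg_left ?_ hω)
    calc |s| = |t + (s - t)| := by congr 1; ring
      _ ≤ _ := abs_add_le _ _
  have hEpos : ∀ s, 0 < E s := fun s => Real.exp_pos _
  have hwt : ∀ s t, E s * v s ≤ M * (E t * v t * E (s - t) + E t * (E (s - t) * v (s - t))) := by
    intro s t
    have h1 := hM' t (s - t)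
    rw [add_sub_cancel] at h1
    calc E s * v s ≤ (E t * E (s - t)) * (M * (v t + v (s - t))) :=
          mul_le_mul (hE s t) h1 (hv.pos s).le (mul_pos (hEpos _) (hEpos _)).le
      _ = _ := by ring
  -- the four non-negative functions entering the estimate
  let Eg : ℝ → ℝ≥0∞ := fun s => ‖((E s : ℝ) : ℂ) * g s‖ₑ
  let Eh : ℝ → ℝ≥0∞ := fun s => ‖((E s : ℝ) : ℂ) * h s‖ₑ
  let Wg : ℝ → ℝ≥0∞ := fun s => ‖weighted v ω g s‖ₑ
  let Wh : ℝ → ℝ≥0∞ := fun s => ‖weighted v ω h s‖ₑ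
  have iEg := hg.integrable_exp hv
  have iEh := hh.integrable_exp hv
  have mEg : AEMeasurable Eg := iEg.aestronglyMeasurable.enorm
  have mEh : AEMeasurable Eh := iEh.aestronglyMeasurable.enorm
  have mWg : AEMeasurable Wg := hg.2.1.enorm
  have mWh : AEMeasurable Wh := hh.2.1.enorm
  have fEg : ∫⁻ s, Eg s < ⊤ := iEg.2
  have fEh : ∫⁻ s, Eh s < ⊤ := iEh.2
  have fWg : ∫⁻ s, Wg s ^ (2 : ℝ) < ⊤ := by
    simpa using lintegral_rpow_enorm_lt_top_of_eLpNorm_lt_top two_ne_zero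
      ENNReal.ofNat_ne_top hg.2.2
  have fWh : ∫⁻ s, Wh s ^ (2 : ℝ) < ⊤ := by
    simpa using lintegral_rpow_enorm_lt_top_of_eLpNorm_lt_top two_ne_zero
      ENNReal.ofNat_ne_top hh.2.2
  let P : ℝ → ℝ≥0∞ := fun s => ∫⁻ t, Eh t * Wg (s - t)
  let Q : ℝ → ℝ≥0∞ := fun s => ∫⁻ t, Eg t * Wh (s - t)
  have fP : ∫⁻ s, P s ^ (2 : ℝ) < ⊤ := (lintegral_conv_sq_le mEh mWg).trans_lt
    (ENNReal.mul_lt_top (ENNReal.rpow_lt_top_of_nonneg zero_le_two fEh.ne) fWg)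
  have fQ : ∫⁻ s, Q s ^ (2 : ℝ) < ⊤ := (lintegral_conv_sq_le mEg mWh).trans_lt
    (ENNReal.mul_lt_top (ENNReal.rpow_lt_top_of_nonneg zero_le_two fEg.ne) fWh)
  have mQ : AEMeasurable Q := by
    have : AEMeasurable (fun p : ℝ × ℝ => Eg p.2 * Wh (p.1 - p.2)) (volume.prod volume) :=
      (mEg.comp_quasiMeasurePreserving Measure.quasiMeasurePreserving_snd).mul
        (mWh.comp_quasiMeasurePreserving
          (quasiMeasurePreserving_sub_of_right_invariant volume volume))
    exact this.lintegral_prod_right'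
  have hP : ∀ s, P s = ∫⁻ t, Wg t * Eh (s - t) := fun s => by
    simp only [P]
    rw [← lintegral_sub_left_eq_self _ s]
    refine lintegral_congr fun t => ?_
    rw [sub_sub_cancel, mul_comm]
  have hsub : ∀ s : ℝ, Measure.QuasiMeasurePreserving (fun t : ℝ => s - t) volume volume :=
    fun s => quasiMeasurePreserving_sub_left volume s
  have hbound : ∀ s, ‖weighted v ω (g ⋆[ContinuousLinearMap.mul ℝ ℂ, volume] h) s‖ₑ ≤
      ENNReal.ofReal M * (P s + Q s) := by
    intro s
    have hn : ∀ r : ℝ, 0 ≤ r → ‖(r : ℂ)‖ₑ = ENNReal.ofReal r := fun r hr => by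
      rw [← ofReal_norm, Complex.norm_real, Real.norm_of_nonneg hr]
    have hEv : ∀ r, 0 ≤ E r * v r := fun r => (mul_pos (hEpos r) (hv.pos r)).le
    have hpt : ∀ t, ‖((E s * v s : ℝ) : ℂ)‖ₑ * ‖g t * h (s - t)‖ₑ ≤
        ENNReal.ofReal M * (Wg t * Eh (s - t) + Eg t * Wh (s - t)) := by
      intro t
      simp only [Wg, Wh, Eg, Eh, weighted, enorm_mul]
      rw [hn _ (hEv s), hn _ (hEpos t).le, hn _ (hEpos (s - t)).le]
      change _ ≤ ENNReal.ofReal M * (‖((E t * v t : ℝ) : ℂ)‖ₑ * _ * _ +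
        _ * (‖((E (s - t) * v (s - t) : ℝ) : ℂ)‖ₑ * _))
      rw [hn _ (hEv t), hn _ (hEv (s - t))]
      calc ENNReal.ofReal (E s * v s) * (‖g t‖ₑ * ‖h (s - t)‖ₑ)
          ≤ ENNReal.ofReal (M * (E t * v t * E (s - t) + E t * (E (s - t) * v (s - t)))) *
              (‖g t‖ₑ * ‖h (s - t)‖ₑ) :=
            mul_le_mul_left (ENNReal.ofReal_le_ofReal (hwt s t)) _
        _ = _ := by
          rw [ENNReal.ofReal_mul hM0, ENNReal.ofReal_add
            (mul_nonneg (hEv t) (hEpos _).le) (mul_nonneg (hEpos t).le (hEv _)),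
            ENNReal.ofReal_mul (hEv t),
            ENNReal.ofReal_mul (p := E t) (hEpos t).le (q := E (s - t) * v (s - t))]
          ring
    calc ‖weighted v ω (g ⋆[ContinuousLinearMap.mul ℝ ℂ, volume] h) s‖ₑ
        = ‖((E s * v s : ℝ) : ℂ)‖ₑ * ‖∫ t, g t * h (s - t)‖ₑ := by
          simp only [weighted, enorm_mul, convolution_def, ContinuousLinearMap.mul_apply', E]
      _ ≤ ‖((E s * v s : ℝ) : ℂ)‖ₑ * ∫⁻ t, ‖g t * h (s - t)‖ₑ := by
          gcongr; exact enorm_integral_le_lintegral_enorm _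
      _ = ∫⁻ t, ‖((E s * v s : ℝ) : ℂ)‖ₑ * ‖g t * h (s - t)‖ₑ :=
          (lintegral_const_mul' _ _ enorm_ne_top).symm
      _ ≤ ∫⁻ t, ENNReal.ofReal M * (Wg t * Eh (s - t) + Eg t * Wh (s - t)) :=
          lintegral_mono hpt
      _ = ENNReal.ofReal M * (P s + Q s) := by
          have hm : AEMeasurable (fun t => Wg t * Eh (s - t)) :=
            mWg.mul (mEh.comp_quasiMeasurePreserving (hsub s))
          rw [lintegral_const_mul' _ _ ENNReal.ofReal_ne_top, hP s, lintegral_add_left' hm]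
  have hWmeas : AEStronglyMeasurable
      (weighted v ω (g ⋆[ContinuousLinearMap.mul ℝ ℂ, volume] h)) volume := by
    have hvm := hv.measurable
    exact (Measurable.aestronglyMeasurable (by fun_prop)).mul hconvint
  have hW : MemLp (weighted v ω (g ⋆[ContinuousLinearMap.mul ℝ ℂ, volume] h)) 2 volume := by
    refine ⟨hWmeas, (eLpNorm_lt_top_iff_lintegral_rpow_enorm_lt_top two_ne_zero
      ENNReal.ofNat_ne_top).2 ?_⟩
    rw [ENNReal.toReal_ofNat]
    calc ∫⁻ s, ‖weighted v ω (g ⋆[ContinuousLinearMap.mul ℝ ℂ, volume] h) s‖ₑ ^ (2 : ℝ)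
        ≤ ∫⁻ s, ENNReal.ofReal M ^ (2 : ℝ) *
            (2 ^ ((2 : ℝ) - 1) * (P s ^ (2 : ℝ) + Q s ^ (2 : ℝ))) := by
          refine lintegral_mono fun s => ?_
          refine (ENNReal.rpow_le_rpow (hbound s) zero_le_two).trans ?_
          rw [ENNReal.mul_rpow_of_nonneg _ _ zero_le_two]
          gcongr
          exact ENNReal.rpow_add_le_mul_rpow_add_rpow _ _ one_le_two
      _ < ⊤ := by
          rw [lintegral_const_mul' _ _ (ENNReal.rpow_ne_top_of_nonneg zero_le_two
            ENNReal.ofReal_ne_top), lintegral_const_mul' _ _ (ENNReal.rpow_ne_top_of_nonneg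
            (by norm_num) ENNReal.ofNat_ne_top), lintegral_add_right' _ (mQ.pow_const _)]
          exact ENNReal.mul_lt_top (ENNReal.rpow_lt_top_of_nonneg zero_le_two
            ENNReal.ofReal_ne_top) (ENNReal.mul_lt_top (ENNReal.rpow_lt_top_of_nonneg
            (by norm_num) ENNReal.ofNat_ne_top) (ENNReal.add_lt_top.2 ⟨fP, fQ⟩))
  refine ⟨hW.mono hconvint (Filter.Eventually.of_forall fun s => ?_), hW⟩
  have h1 : 1 ≤ E s * v s := by
    have : 1 ≤ E s := Real.one_le_exp (mul_nonneg hω (abs_nonneg s))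
    nlinarith [hv.one_le s]
  rw [weighted, norm_mul, Complex.norm_real, Real.norm_of_nonneg (zero_le_one.trans h1)]
  exact le_mul_of_one_le_left (norm_nonneg _) h1

/-- The Fourier transform on the strip turns convolutions into products. -/
theorem stripFourier_convolution (hv : StronglyAdmissible v)
    (hg : MemWeightedL2 v ω g) (hh : MemWeightedL2 v ω h) :
    stripFourier ω (g ⋆[ContinuousLinearMap.mul ℝ ℂ, volume] h) =
      stripFourier ω g * stripFourier ω h := by
  funext z
  have hint := integral_convolution (ContinuousLinearMap.mul ℝ ℂ) (hg.integrable_kernel hv z)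
    (hh.integrable_kernel hv z)
  simp only [ContinuousLinearMap.mul_apply'] at hint
  simp only [Pi.mul_apply, stripFourier]
  rw [← hint]
  refine integral_congr_ae (Filter.Eventually.of_forall fun s => ?_)
  simp only [convolution_def, ContinuousLinearMap.mul_apply']
  rw [← integral_const_mul]
  refine integral_congr_ae (Filter.Eventually.of_forall fun t => ?_)
  have : Complex.exp (-Complex.I * s * (z : ℂ)) = Complex.exp (-Complex.I * t * (z : ℂ)) *
      Complex.exp (-Complex.I * ((s - t : ℝ) : ℂ) * (z : ℂ)) := by
    rw [← Complex.exp_add]; congr 1; push_cast; ring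
  simp only [this]
  ring

/-- The generalized Sobolev space `W²_v(St_ω) = {ĝ | g ∈ L²_{v,ω}(ℝ)}`, an algebra of functions
on the closed strip with respect to pointwise multiplication. -/
noncomputable def sobolevAlgebra (hv : StronglyAdmissible v) (hω : 0 ≤ ω) :
    NonUnitalSubalgebra ℂ (ClosedStrip ω → ℂ) where
  carrier := {f | ∃ g, IsInvFourier v ω f g}
  zero_mem' := ⟨0, memWeightedL2_zero, by funext z; simp [stripFourier]⟩
  add_mem' := by
    rintro _ _ ⟨a, ha, rfl⟩ ⟨b, hb, rfl⟩
    refine ⟨a + b, ha.add hb, ?_⟩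
    funext z
    simp only [Pi.add_apply, stripFourier, mul_add]
    exact (integral_add (ha.integrable_kernel hv z) (hb.integrable_kernel hv z)).symm
  smul_mem' := by
    rintro c _ ⟨a, ha, rfl⟩
    refine ⟨c • a, ha.smul c, ?_⟩
    funext z
    simp only [Pi.smul_apply, stripFourier, smul_eq_mul]
    rw [← integral_const_mul]
    exact integral_congr_ae (Filter.Eventually.of_forall fun s => by ring)
  mul_mem' := by
    rintro _ _ ⟨a, ha, rfl⟩ ⟨b, hb, rfl⟩
    exact ⟨_, ha.convolution hv hω hb, (stripFourier_convolution hv ha hb).symm⟩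

/-! ### Groups, generators and resolvents -/

section Operators

variable {X : Type*} [NormedAddCommGroup X] [NormedSpace ℂ X]

/-- A `C₀`-group `(U_s)_{s ∈ ℝ}` of bounded operators on `X`. -/
structure C0Group (X : Type*) [NormedAddCommGroup X] [NormedSpace ℂ X] where
  toFun : ℝ → X →L[ℂ] X
  map_zero : toFun 0 = ContinuousLinearMap.id ℂ X
  map_add : ∀ s t, toFun (s + t) = (toFun s).comp (toFun t)
  continuous : ∀ x, Continuous fun s => toFun s x

instance : CoeFun (C0Group X) (fun _ => ℝ → X →L[ℂ] X) := ⟨C0Group.toFun⟩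

/-- The generator of a `C₀`-group: `x` is in its domain iff `s ↦ U_s x` is differentiable at `0`,
and it maps such an `x` to the derivative. -/
noncomputable def C0Group.generator (U : C0Group X) : X →ₗ.[ℂ] X where
  domain :=
    { carrier := {x | DifferentiableAt ℝ (fun s => U s x) 0}
      zero_mem' := by simp
      add_mem' := fun {x y} hx hy => by
        have h : DifferentiableAt ℝ (fun s => U s x + U s y) 0 := DifferentiableAt.add hx hy
        simpa using h
      smul_mem' := fun c x hx => by
        have h : DifferentiableAt ℝ (fun s => c • U s x) 0 := DifferentiableAt.const_smul hx c
        simpa using h }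
  toFun :=
    { toFun := fun x => deriv (fun s => U s (x : X)) 0
      map_add' := fun x y => by
        have h : deriv (fun s => U s (x : X) + U s (y : X)) 0 = _ := deriv_add x.2 y.2
        simpa using h
      map_smul' := fun c x => by
        have h : deriv (fun s => c • U s (x : X)) 0 = _ := deriv_const_smul c x.2
        simpa using h }

/-- `R = R(λ, A) = (λ - A)⁻¹`: the operator `λ - A : dom A → X` is bijective with the bounded
inverse `R`. -/
def IsResolvent (A : X →ₗ.[ℂ] X) (l : ℂ) (R : X →L[ℂ] X) : Prop :=
  (∀ y : A.domain, R (l • (y : X) - A y) = y) ∧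
    ∀ x : X, ∃ y : A.domain, (y : X) = R x ∧ l • (y : X) - A y = x

/-! ### The bounded Sobolev calculus -/

/-- `Ψ(r_λ) = R(λ, A)`, where `r_λ = (λ - z)⁻¹` belongs to `W²_v(St_ω)`. -/
def MapsToResolvent (hv : StronglyAdmissible v) (hω : 0 ≤ ω) (A : X →ₗ.[ℂ] X)
    (Ψ : sobolevAlgebra hv hω →ₙₐ[ℂ] (X →L[ℂ] X)) (l : ℂ) : Prop :=
  ∃ r : sobolevAlgebra hv hω,
    (∀ z : ClosedStrip ω, (r : ClosedStrip ω → ℂ) z = (l - z)⁻¹) ∧ IsResolvent A l (Ψ r)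

/-- `Ψ` is a bounded `W²_v(St_ω)`-calculus for `A`: an algebra homomorphism that is bounded for
the norm `‖ĝ‖ = ‖g‖_{L²_{v,ω}}` and maps `r_λ` to `R(λ, A)` for some `λ` off the closed strip. -/
structure IsBoundedSobolevCalculus (hv : StronglyAdmissible v) (hω : 0 ≤ ω) (A : X →ₗ.[ℂ] X)
    (Ψ : sobolevAlgebra hv hω →ₙₐ[ℂ] (X →L[ℂ] X)) : Prop where
  bounded : ∃ C : ℝ, ∀ (f : sobolevAlgebra hv hω) (g : ℝ → ℂ),
    IsInvFourier v ω (f : ClosedStrip ω → ℂ) g → ‖Ψ f‖ ≤ C * weightedL2Norm v ω g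
  resolvent : ∃ l : ℂ, ω < |l.im| ∧ MapsToResolvent hv hω A Ψ l

/-- `A` has a bounded `W²_v(St_ω)`-calculus. -/
def HasBoundedSobolevCalculus (hv : StronglyAdmissible v) (hω : 0 ≤ ω) (A : X →ₗ.[ℂ] X) : Prop :=
  ∃ Ψ : sobolevAlgebra hv hω →ₙₐ[ℂ] (X →L[ℂ] X), IsBoundedSobolevCalculus hv hω A Ψ

end Operators

end SobolevCalculus

/-!
For `g` in a dense subspace of `L²_{v,ω}(ℝ)`, for instance for `g` of compact support, the integral
`∫ g(s) U_s ds` converges strongly. Under condition (i), Cauchy-Schwarz bounds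
`⟨∫ g(s) U_s x ds, x'⟩` by the norm of `g` times a constant depending on `x` and `x'`; by uniform
boundedness the norm of `g` bounds the operator norm too, so the weak integral exists for all `g`.
The weak integral turns convolutions into products, and for the inverse Fourier transform of
`(l - z)⁻¹` with large `Im l` it is the Laplace transform of the group, which is `(l - A)⁻¹`.

Conversely, given a bounded calculus `Ψ`, the functional `f ↦ ⟨Ψ(f)x, x'⟩` on the Hilbert space
`W²_v(St_ω) ≅ L²(ℝ)` is of the form `f ↦ ∫ f^∨(s) u(s) ds` with `exp (-ω |s|) u / v` in `L²(ℝ)`. The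
resolvent identity gives `Ψ((l - z)⁻¹) = (l - A)⁻¹` for all `|Im l| > ω`, so `u` and the orbit
`⟨U_s x, x'⟩` have the same Laplace transforms on both half-lines for large `|Im l|`, and `u` equals
the orbit almost everywhere by injectivity of the Fourier transform.
-/

namespace SobolevCalculus

/-! ### Growth of quasi-subadditive functions and of strongly admissible weights -/

section Growth

theorem exists_eventually_le_of_quasi_subadditive {G : Type*} [AddGroup G] [TopologicalSpace G]
    [IsTopologicalAddGroup G] [LocallyCompactSpace G] [SecondCountableTopology G]
    [MeasurableSpace G] [BorelSpace G] {f : G → ℝ} (hf : Measurable f) {M : ℝ} (hM : 0 ≤ M)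
    (hfM : ∀ s t, f (s + t) ≤ M * (f s + f t)) : ∃ C, ∀ᶠ s in nhds 0, f s ≤ C := by
  let S : ℕ → Set G := fun n => {t | f t ≤ n ∧ f (-t) ≤ n}
  have measurableSet_S : ∀ n, MeasurableSet (S n) := fun n =>
    (measurableSet_le hf measurable_const).inter
      (measurableSet_le (hf.comp measurable_neg) measurable_const)
  have iUnion_S : ⋃ n, S n = Set.univ := by
    refine Set.eq_univ_of_forall fun t => ?_
    obtain ⟨n, hn⟩ := exists_nat_ge (max (f t) (f (-t)))
    exact Set.mem_iUnion.2 ⟨n, max_le_iff.1 hn⟩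
  obtain ⟨n, hn⟩ : ∃ n, 0 < Measure.addHaar (S n) :=
    exists_measure_pos_of_not_measure_iUnion_null (by simp [iUnion_S, NeZero.ne])
  refine ⟨M * (n + n), ?_⟩
  filter_upwards [Measure.sub_mem_nhds_zero_of_addHaar_pos Measure.addHaar (S n)
    (measurableSet_S n) hn]
  rintro _ ⟨s, hs, t, ht, rfl⟩
  calc f (s - t) ≤ M * (f s + f (-t)) := sub_eq_add_neg s t ▸ hfM s (-t)
    _ ≤ M * (n + n) := by gcongr; exacts [hs.1, ht.2]

variable {E : Type*} [SeminormedAddCommGroup E] [NormedSpace ℝ E] {f : E → ℝ} {K : ℝ}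

theorem exists_le_mul_pow_norm_of_doubling (hf : ∀ s, 0 ≤ f s)
    (hdouble : ∀ s, f s ≤ K * f ((2⁻¹ : ℝ) • s)) (hloc : ∃ C, ∀ᶠ s in nhds 0, f s ≤ C) :
    ∃ C r : ℝ, ∃ k : ℕ, 0 ≤ C ∧ 0 < r ∧ ∀ s, f s ≤ C * max 1 (r * ‖s‖) ^ k := by
  obtain ⟨C, hC⟩ := hloc
  obtain ⟨δ, hδ, hball⟩ := Metric.eventually_nhds_iff.1 hC
  simp only [dist_zero_right] at hball
  have hC0 : 0 ≤ C := (hf 0).trans (hball (by simpa using hδ))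
  obtain ⟨k, hk⟩ := pow_unbounded_of_one_lt K one_lt_two
  have near : ∀ s, ‖s‖ < δ → f s ≤ C * max 1 (2 / δ * ‖s‖) ^ k := fun s hs =>
    (hball hs).trans (le_mul_of_one_le_right hC0 (one_le_pow₀ (le_max_left _ _)))
  have scaled : ∀ (n : ℕ) (s : E), ‖s‖ < 2 ^ n * δ → f s ≤ C * max 1 (2 / δ * ‖s‖) ^ k := by
    intro n
    induction n with
    | zero => exact fun s hs => near s (by simpa using hs)
    | succ n ih =>
      intro s hs
      rcases lt_or_ge ‖s‖ δ with hsδ | hsδ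
      · exact near s hsδ
      have norm_half : ‖(2⁻¹ : ℝ) • s‖ = ‖s‖ / 2 := by
        rw [norm_smul, norm_inv, Real.norm_two]; ring
      have max_half : max 1 (2 / δ * (‖s‖ / 2)) = ‖s‖ / δ := by
        rw [show 2 / δ * (‖s‖ / 2) = ‖s‖ / δ by ring]
        exact max_eq_right ((one_le_div hδ).2 hsδ)
      have half := ih ((2⁻¹ : ℝ) • s) (by rw [norm_half]; rw [pow_succ] at hs; linarith)
      rw [norm_half, max_half] at half
      calc f s ≤ 2 ^ k * (C * (‖s‖ / δ) ^ k) :=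
            (hdouble s).trans (mul_le_mul hk.le half (hf _) (by positivity))
        _ = C * (2 / δ * ‖s‖) ^ k := by rw [mul_left_comm, ← mul_pow]; ring
        _ ≤ C * max 1 (2 / δ * ‖s‖) ^ k := by gcongr; exact le_max_right _ _
  refine ⟨C, 2 / δ, k, hC0, by positivity, fun s => ?_⟩
  obtain ⟨n, hn⟩ := pow_unbounded_of_one_lt (‖s‖ / δ) one_lt_two
  exact scaled n s ((div_lt_iff₀ hδ).1 hn)

theorem exists_le_mul_exp_norm_of_doubling (hf : ∀ s, 0 ≤ f s)
    (hdouble : ∀ s, f s ≤ K * f ((2⁻¹ : ℝ) • s)) (hloc : ∃ C, ∀ᶠ s in nhds 0, f s ≤ C)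
    {ε : ℝ} (hε : 0 < ε) : ∃ C, ∀ s, f s ≤ C * Real.exp (ε * ‖s‖) := by
  obtain ⟨C, r, k, hC, hr, hle⟩ := exists_le_mul_pow_norm_of_doubling hf hdouble hloc
  refine ⟨C * ((r / ε) ^ k * (k.factorial * Real.exp (ε / r))), fun s => (hle s).trans ?_⟩
  have hexp : (ε / r * max 1 (r * ‖s‖)) ^ k ≤
      k.factorial * (Real.exp (ε / r) * Real.exp (ε * ‖s‖)) := by
    rw [← div_le_iff₀' (by positivity), ← Real.exp_add]
    refine (Real.pow_div_factorial_le_exp _ (by positivity) k).trans (Real.exp_le_exp.2 ?_)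
    calc ε / r * max 1 (r * ‖s‖) ≤ ε / r * (1 + r * ‖s‖) := by
          gcongr; exact max_le (by linarith [show 0 ≤ r * ‖s‖ by positivity]) (by linarith)
      _ = ε / r + ε * ‖s‖ := by field_simp
  calc C * max 1 (r * ‖s‖) ^ k = C * ((r / ε) ^ k * (ε / r * max 1 (r * ‖s‖)) ^ k) := by
        rw [← mul_pow]; congr 2; field_simp
    _ ≤ C * ((r / ε) ^ k * (k.factorial * (Real.exp (ε / r) * Real.exp (ε * ‖s‖)))) := by gcongr
    _ = _ := by ring

theorem integrable_exp_neg_mul_abs {ε : ℝ} (hε : 0 < ε) :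
    Integrable fun s : ℝ => Real.exp (-ε * |s|) := by
  have right : IntegrableOn (fun s : ℝ => Real.exp (-ε * |s|)) (Set.Ioi 0) :=
    (exp_neg_integrableOn_Ioi 0 hε).congr_fun
      (fun s hs => by simp only [abs_of_pos (Set.mem_Ioi.1 hs)]) measurableSet_Ioi
  have left : IntegrableOn (fun s : ℝ => Real.exp (-ε * |s|)) (Set.Iic 0) := by
    rw [← integrableOn_Ici_iff_integrableOn_Ioi] at right
    simpa only [abs_neg, Set.neg_Ici, neg_zero] using right.comp_neg
  rw [← integrableOn_univ, ← Set.Iic_union_Ioi (a := (0 : ℝ))]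
  exact left.union right

end Growth

section StronglyAdmissible

variable {v : ℝ → ℝ}

theorem StronglyAdmissible.exists_quasi_subadditive (hv : StronglyAdmissible v) :
    ∃ M : ℝ, 0 ≤ M ∧ ∀ s t, v (s + t) ≤ M * (v s + v t) := by
  obtain ⟨M, hM⟩ := hv.bddAbove
  have hpos : ∀ s t, 0 < v s + v t := fun s t => add_pos (hv.pos s) (hv.pos t)
  exact ⟨M, (div_pos (hv.pos _) (hpos 0 0)).le.trans (hM (Set.mem_range_self (0, 0))),
    fun s t => (div_le_iff₀ (hpos s t)).1 (hM (Set.mem_range_self (s, t)))⟩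

theorem StronglyAdmissible.exists_le_exp (hv : StronglyAdmissible v) {ε : ℝ} (hε : 0 < ε) :
    ∃ C, ∀ s, v s ≤ C * Real.exp (ε * |s|) := by
  obtain ⟨M, hM, hle⟩ := hv.exists_quasi_subadditive
  refine exists_le_mul_exp_norm_of_doubling (K := 2 * M) (fun s => (hv.pos s).le) (fun s => ?_)
    (exists_eventually_le_of_quasi_subadditive hv.measurable hM hle) hε
  calc v s = v ((2⁻¹ : ℝ) • s + (2⁻¹ : ℝ) • s) := by rw [smul_eq_mul]; congr 1; ring
    _ ≤ 2 * M * v ((2⁻¹ : ℝ) • s) := (hle _ _).trans_eq (by ring)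

theorem StronglyAdmissible.memLp_exp_mul (hv : StronglyAdmissible v) {ε : ℝ} (hε : 0 < ε) :
    MemLp (fun s => Real.exp (-ε * |s|) * v s) 2 volume := by
  obtain ⟨C, hC⟩ := hv.exists_le_exp (half_pos hε)
  have hmeas : Measurable fun s => Real.exp (-ε * |s|) * v s := by
    have := hv.measurable; fun_prop
  rw [memLp_two_iff_integrable_sq hmeas.aestronglyMeasurable]
  refine ((integrable_exp_neg_mul_abs hε).const_mul (C ^ 2)).mono'
    (hmeas.pow_const 2).aestronglyMeasurable (Filter.Eventually.of_forall fun s => ?_)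
  rw [Real.norm_of_nonneg (by positivity)]
  calc (Real.exp (-ε * |s|) * v s) ^ 2
      ≤ (Real.exp (-ε * |s|) * (C * Real.exp (ε / 2 * |s|))) ^ 2 := by
        have := (hv.pos s).le
        gcongr
        exact hC s
    _ = C ^ 2 * Real.exp (-ε * |s|) := by
        rw [mul_left_comm, ← Real.exp_add, mul_pow, ← Real.exp_nat_mul]
        congr 2; push_cast; ring

end StronglyAdmissible

/-! ### The inverse Fourier transform of a simple pole -/

section ResolventKernel

/-- The inverse Fourier transform of `z ↦ (l - z)⁻¹` for non-real `l`: an exponential supported on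
the half-line on which it decays. -/
noncomputable def resolventKernel (l : ℂ) : ℝ → ℂ :=
  if 0 < l.im then (Set.Ioi 0).indicator fun s : ℝ => -Complex.I * Complex.exp (Complex.I * l * s)
  else (Set.Iic 0).indicator fun s : ℝ => Complex.I * Complex.exp (Complex.I * l * s)

variable {E : Type*} [NormedAddCommGroup E] [NormedSpace ℂ E] {l : ℂ} {F F' : ℝ → E}

theorem measurable_resolventKernel : Measurable (resolventKernel l) := by
  unfold resolventKernel
  split_ifs
  · exact Measurable.indicator (by fun_prop) measurableSet_Ioi
  · exact Measurable.indicator (by fun_prop) measurableSet_Iic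

theorem norm_resolventKernel_le (l : ℂ) (s : ℝ) :
    ‖resolventKernel l s‖ ≤ Real.exp (-|l.im| * |s|) := by
  have norm_exp : ‖Complex.exp (Complex.I * l * s)‖ = Real.exp (-l.im * s) := by
    rw [Complex.norm_exp]; simp
  unfold resolventKernel
  split_ifs with hl <;> refine (norm_indicator_eq_indicator_norm _ s).trans_le
    (Set.indicator_apply_le' (fun hs => ?_) fun _ => (Real.exp_pos _).le)
  · rw [norm_mul, norm_neg, Complex.norm_I, one_mul, norm_exp, abs_of_pos hl,
      abs_of_pos (Set.mem_Ioi.1 hs)]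
  · rw [norm_mul, Complex.norm_I, one_mul, norm_exp, abs_of_nonpos (not_lt.1 hl),
      abs_of_nonpos (Set.mem_Iic.1 hs), neg_neg, mul_neg, neg_mul]

theorem resolventKernel_smul_of_im_pos (hl : 0 < l.im) (F : ℝ → E) :
    (fun s => resolventKernel l s • F s) =
      (Set.Ioi 0).indicator fun s : ℝ => -Complex.I • Complex.exp (Complex.I * l * s) • F s := by
  funext s
  simp only [resolventKernel, if_pos hl, Set.indicator_apply, ite_smul, zero_smul, smul_smul]

theorem resolventKernel_smul_of_im_nonpos (hl : l.im ≤ 0) (F : ℝ → E) :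
    (fun s => resolventKernel l s • F s) =
      (Set.Iic 0).indicator fun s : ℝ => Complex.I • Complex.exp (Complex.I * l * s) • F s := by
  funext s
  simp only [resolventKernel, if_neg hl.not_gt, Set.indicator_apply, ite_smul, zero_smul, smul_smul]

theorem integrable_resolventKernel_smul {a C : ℝ} (hl : a < |l.im|)
    (hF : AEStronglyMeasurable F) (hFC : ∀ s, ‖F s‖ ≤ C * Real.exp (a * |s|)) :
    Integrable fun s => resolventKernel l s • F s := by
  refine ((integrable_exp_neg_mul_abs (sub_pos.2 hl)).const_mul C).mono'
    (measurable_resolventKernel.aestronglyMeasurable.smul hF)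
    (Filter.Eventually.of_forall fun s => ?_)
  rw [norm_smul]
  calc ‖resolventKernel l s‖ * ‖F s‖
      ≤ Real.exp (-|l.im| * |s|) * (C * Real.exp (a * |s|)) :=
        mul_le_mul (norm_resolventKernel_le l s) (hFC s) (norm_nonneg _) (Real.exp_pos _).le
    _ = C * Real.exp (-(|l.im| - a) * |s|) := by
        rw [mul_left_comm, ← Real.exp_add]; congr 2; ring

theorem hasDerivAt_exp_smul (l : ℂ) {y' : E} {s : ℝ} (hF : HasDerivAt F y' s) :
    HasDerivAt (fun t : ℝ => Complex.exp (Complex.I * l * t) • F t)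
      (Complex.I • Complex.exp (Complex.I * l * s) • (l • F s - Complex.I • y')) s := by
  have hexp : HasDerivAt (fun t : ℝ => Complex.exp (Complex.I * l * t))
      (Complex.exp (Complex.I * l * s) * (Complex.I * l)) s := by
    simpa using ((hasDerivAt_id (s : ℂ)).const_mul (Complex.I * l)).cexp.comp_ofReal
  refine (hexp.smul hF).congr_deriv ?_
  linear_combination (norm := module) Complex.I_mul_I • Complex.exp (Complex.I * l * s) • y'

/-- Integration by parts: `k_l • (l F - i F')` is, up to sign, the derivative of `exp (i l s) F`,
which vanishes at the infinite end of the half-line. -/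
theorem integral_resolventKernel_smul_sub_deriv [CompleteSpace E]
    (hF : ∀ s, HasDerivAt F (F' s) s) (hint : Integrable fun s => resolventKernel l s • F s)
    (hint' : Integrable fun s => resolventKernel l s • F' s) :
    ∫ s, resolventKernel l s • (l • F s - Complex.I • F' s) = F 0 := by
  have hderiv := fun s => hasDerivAt_exp_smul l (hF s)
  have hsum : Integrable fun s => resolventKernel l s • (l • F s - Complex.I • F' s) := by
    simp only [smul_sub, smul_comm (resolventKernel l _)]
    exact (hint.smul l).sub (hint'.smul Complex.I)
  rcases lt_or_ge 0 l.im with hl | hl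
  · rw [resolventKernel_smul_of_im_pos hl, integrable_indicator_iff measurableSet_Ioi] at hint hsum
    rw [resolventKernel_smul_of_im_pos hl, integral_indicator measurableSet_Ioi]
    simp only [neg_smul] at hint hsum ⊢
    have hG := (integrable_smul_iff Complex.I_ne_zero _).1 (integrable_neg_iff.1 hint)
    have hG' := integrable_neg_iff.1 hsum
    rw [integral_neg, integral_Ioi_of_hasDerivAt_of_tendsto' (fun s _ => hderiv s) hG'
      (tendsto_zero_of_hasDerivAt_of_integrableOn_Ioi (fun s _ => hderiv s) hG' hG)]
    simp
  · rw [resolventKernel_smul_of_im_nonpos hl, integrable_indicator_iff measurableSet_Iic]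
      at hint hsum
    rw [resolventKernel_smul_of_im_nonpos hl, integral_indicator measurableSet_Iic]
    have hG := (integrable_smul_iff Complex.I_ne_zero _).1 hint
    rw [integral_Iic_of_hasDerivAt_of_tendsto' (fun s _ => hderiv s) hsum
      (tendsto_zero_of_hasDerivAt_of_integrableOn_Iic (fun s _ => hderiv s) hsum hG)]
    simp

variable {ω : ℝ}

theorem stripFourier_resolventKernel (hl : ω < |l.im|) (z : ClosedStrip ω) :
    stripFourier ω (resolventKernel l) z = (l - z)⁻¹ := by
  have hF : ∀ s : ℝ, HasDerivAt (fun s : ℝ => Complex.exp (-Complex.I * s * (z : ℂ)))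
      (-Complex.I * z * Complex.exp (-Complex.I * s * z)) s := fun s => by
    simpa [mul_comm] using
      (((hasDerivAt_id (s : ℂ)).const_mul (-Complex.I)).mul_const (z : ℂ)).cexp.comp_ofReal
  have hint : Integrable fun s : ℝ => resolventKernel l s • Complex.exp (-Complex.I * s * z) :=
    integrable_resolventKernel_smul hl (Continuous.aestronglyMeasurable (by fun_prop))
      fun s => (norm_exp_strip z s).trans_eq (one_mul _).symm
  have hint' : Integrable fun s : ℝ =>
      resolventKernel l s • (-Complex.I * z * Complex.exp (-Complex.I * s * z)) := by
    simpa only [smul_eq_mul, mul_left_comm] using hint.const_mul (-Complex.I * z)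
  have factor : ∀ s : ℝ, resolventKernel l s • (l • Complex.exp (-Complex.I * s * z) -
      Complex.I • (-Complex.I * z * Complex.exp (-Complex.I * s * z))) =
        (l - z) * (Complex.exp (-Complex.I * s * z) * resolventKernel l s) := fun s => by
    simp only [smul_eq_mul]
    linear_combination (resolventKernel l s * z * Complex.exp (-Complex.I * s * z)) *
      Complex.I_mul_I
  refine eq_inv_of_mul_eq_one_right ?_
  calc (l - z) * stripFourier ω (resolventKernel l) z
      = ∫ s : ℝ, resolventKernel l s • (l • Complex.exp (-Complex.I * s * z) -
          Complex.I • (-Complex.I * z * Complex.exp (-Complex.I * s * z))) := by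
        simp only [factor, integral_const_mul, stripFourier]
    _ = 1 := by rw [integral_resolventKernel_smul_sub_deriv hF hint hint']; simp

end ResolventKernel

/-! ### Duality -/

section Duality

theorem exists_norm_le_of_forall_dual {ι 𝕜 E F : Type*} [RCLike 𝕜] [NormedAddCommGroup E]
    [NormedSpace 𝕜 E] [CompleteSpace E] [NormedAddCommGroup F] [NormedSpace 𝕜 F]
    {T : ι → E →L[𝕜] F} (hT : ∀ x (y' : StrongDual 𝕜 F), ∃ C, ∀ i, ‖y' (T i x)‖ ≤ C) :
    ∃ C, ∀ i, ‖T i‖ ≤ C := by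
  refine banach_steinhaus fun x => ?_
  obtain ⟨C, hC⟩ :=
    banach_steinhaus (g := fun i => NormedSpace.inclusionInDoubleDualLi 𝕜 (T i x)) (hT x)
  exact ⟨C, fun i => ((NormedSpace.inclusionInDoubleDualLi 𝕜).norm_map (T i x)).ge.trans (hC i)⟩

theorem exists_norm_le_mul_of_forall_dual {ι 𝕜 E F : Type*} [RCLike 𝕜] [NormedAddCommGroup E]
    [NormedSpace 𝕜 E] [CompleteSpace E] [NormedAddCommGroup F] [NormedSpace 𝕜 F]
    {T : ι → E →L[𝕜] F} {r : ι → ℝ} (hr : ∀ i, 0 ≤ r i) {N : E → StrongDual 𝕜 F → ℝ}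
    (hT : ∀ i x y', ‖y' (T i x)‖ ≤ r i * N x y') : ∃ C, ∀ i, ‖T i‖ ≤ C * r i := by
  have scaled : ∀ i x y', ‖y' ((((r i)⁻¹ : ℝ) : 𝕜) • T i x)‖ ≤ |N x y'| := fun i x y' => by
    rw [map_smul, norm_smul, RCLike.norm_ofReal, abs_of_nonneg (inv_nonneg.2 (hr i))]
    rcases (hr i).eq_or_lt with h | h
    · simp [← h]
    · exact (inv_mul_le_iff₀ h).2 ((hT i x y').trans (by gcongr; exact le_abs_self _))
  obtain ⟨C, hC⟩ := exists_norm_le_of_forall_dual (T := fun i => (((r i)⁻¹ : ℝ) : 𝕜) • T i)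
    fun x y' => ⟨_, fun i => scaled i x y'⟩
  refine ⟨C, fun i => ?_⟩
  rcases (hr i).eq_or_lt with h | h
  · have : T i = 0 := by
      ext x
      refine SeparatingDual.eq_iff_forall_dual_eq (R := 𝕜).2 fun y' => ?_
      simpa [← h] using hT i x y'
    simp [this, ← h]
  · have := hC i
    rwa [norm_smul, RCLike.norm_ofReal, abs_of_nonneg (inv_nonneg.2 (hr i)),
      inv_mul_le_iff₀ h, mul_comm] at this

variable {α 𝕜 : Type*} [RCLike 𝕜] [MeasurableSpace α] {μ : Measure α}

theorem norm_integral_mul_le {f g : α → 𝕜} (hf : MemLp f 2 μ) (hg : MemLp g 2 μ) :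
    ‖∫ a, f a * g a ∂μ‖ ≤ (eLpNorm f 2 μ).toReal * (eLpNorm g 2 μ).toReal := by
  rw [← ENNReal.toReal_mul, ← toReal_enorm]
  refine ENNReal.toReal_mono (ENNReal.mul_ne_top hf.2.ne hg.2.ne) ?_
  refine (enorm_integral_le_lintegral_enorm _).trans ?_
  rw [← eLpNorm_one_eq_lintegral_enorm]
  exact eLpNorm_smul_le_mul_eLpNorm (φ := f) (f := g) hg.1 hf.1

theorem exists_memLp_forall_apply_eq_integral_mul (L : StrongDual 𝕜 (Lp 𝕜 2 μ)) :
    ∃ ψ, MemLp ψ 2 μ ∧ ∀ φ : Lp 𝕜 2 μ, L φ = ∫ a, φ a * ψ a ∂μ := by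
  let ψ := (InnerProductSpace.toDual 𝕜 (Lp 𝕜 2 μ)).symm L
  refine ⟨fun a => star (ψ a), (Lp.memLp ψ).star, fun φ => ?_⟩
  simp only [← InnerProductSpace.toDual_symm_apply (𝕜 := 𝕜) (y := L), L2.inner_def,
    RCLike.inner_apply, starRingEnd_apply, ψ]

theorem integral_convolution_mul {G : Type*} [AddCommGroup G] [MeasurableSpace G]
    [MeasurableAdd₂ G] {ν : Measure G} [SFinite ν] [ν.IsAddLeftInvariant]
    {g h u : G → 𝕜}
    (hint : Integrable (fun p : G × G => g p.2 * h (p.1 - p.2) * u p.1) (ν.prod ν)) :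
    ∫ r, (g ⋆[ContinuousLinearMap.mul ℝ 𝕜, ν] h) r * u r ∂ν =
      ∫ s, g s * ∫ t, h t * u (s + t) ∂ν ∂ν :=
  calc ∫ r, (g ⋆[ContinuousLinearMap.mul ℝ 𝕜, ν] h) r * u r ∂ν
      = ∫ r, ∫ s, g s * h (r - s) * u r ∂ν ∂ν := by
        simp only [convolution_def, ContinuousLinearMap.mul_apply', integral_mul_const]
    _ = ∫ s, ∫ r, g s * h (r - s) * u r ∂ν ∂ν := integral_integral_swap hint
    _ = ∫ s, g s * ∫ t, h t * u (s + t) ∂ν ∂ν := by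
        congr 1 with s
        rw [← integral_const_mul, ← integral_add_left_eq_self _ s]
        simp only [add_sub_cancel_left, mul_assoc]

end Duality

/-! ### The weighted space and its dual -/

section WeightedSpace

variable {v : ℝ → ℝ} {ω : ℝ} {f g h u : ℝ → ℂ} {l : ℂ}

/-- The function `exp (-ω |s|) u / v`. Under the pairing `∫ g u`, the dual of `L²_{v,ω}(ℝ)` consists
of the functions `u` for which it belongs to `L²(ℝ)`. -/
noncomputable def unweighted (v : ℝ → ℝ) (ω : ℝ) (u : ℝ → ℂ) (s : ℝ) : ℂ :=
  ((Real.exp (-ω * |s|) / v s : ℝ) : ℂ) * u s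

theorem weighted_sub (g h : ℝ → ℂ) :
    weighted v ω (g - h) = weighted v ω g - weighted v ω h := by
  funext s
  simp [weighted, mul_sub]

theorem unweighted_sub (g h : ℝ → ℂ) :
    unweighted v ω (g - h) = unweighted v ω g - unweighted v ω h := by
  funext s
  simp [unweighted, mul_sub]

theorem unweighted_add (g h : ℝ → ℂ) :
    unweighted v ω (g + h) = unweighted v ω g + unweighted v ω h := by
  funext s
  simp [unweighted, mul_add]

theorem unweighted_smul (c : ℂ) (g : ℝ → ℂ) : unweighted v ω (c • g) = c • unweighted v ω g := by
  funext s
  simp [unweighted, mul_left_comm]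

theorem unweighted_congr_ae (h : f =ᵐ[volume] g) :
    unweighted v ω f =ᵐ[volume] unweighted v ω g :=
  (Filter.EventuallyEq.refl _ _).mul h

theorem StronglyAdmissible.weighted_mul_unweighted (hv : StronglyAdmissible v) (g u : ℝ → ℂ)
    (s : ℝ) : weighted v ω g s * unweighted v ω u s = g s * u s := by
  have weight_mul_inv :
      ((Real.exp (ω * |s|) * v s : ℝ) : ℂ) * ((Real.exp (-ω * |s|) / v s : ℝ) : ℂ) = 1 := by
    have := (hv.pos s).ne'
    rw [← Complex.ofReal_mul, neg_mul, Real.exp_neg, ← Complex.ofReal_one]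
    congr 1
    field_simp
  rw [weighted, unweighted, mul_mul_mul_comm, weight_mul_inv, one_mul]

theorem StronglyAdmissible.weighted_unweighted (hv : StronglyAdmissible v) (u : ℝ → ℂ) :
    weighted v ω (unweighted v ω u) = u := by
  funext s
  simpa only [weighted, Pi.one_apply, mul_one, one_mul] using
    hv.weighted_mul_unweighted (ω := ω) 1 u s

theorem StronglyAdmissible.unweighted_weighted (hv : StronglyAdmissible v) (g : ℝ → ℂ) :
    unweighted v ω (weighted v ω g) = g := by
  funext s
  rw [unweighted, mul_comm]
  simpa only [unweighted, Pi.one_apply, mul_one] using hv.weighted_mul_unweighted (ω := ω) g 1 s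

theorem StronglyAdmissible.norm_unweighted_le (hv : StronglyAdmissible v) (hω : 0 ≤ ω)
    (u : ℝ → ℂ) (s : ℝ) : ‖unweighted v ω u s‖ ≤ ‖u s‖ := by
  have exp_le_one : Real.exp (-ω * |s|) ≤ 1 :=
    Real.exp_le_one_iff.2 (mul_nonpos_of_nonpos_of_nonneg (neg_nonpos.2 hω) (abs_nonneg s))
  rw [unweighted, norm_mul, Complex.norm_real, Real.norm_of_nonneg
    (div_nonneg (Real.exp_pos _).le (hv.pos s).le)]
  exact mul_le_of_le_one_left (norm_nonneg _)
    ((div_le_one (hv.pos s)).2 (exp_le_one.trans (hv.one_le s)))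

theorem memLp_unweighted_mono {a : ℝ} (ha : ω ≤ a) (hu : MemLp (unweighted v ω u) 2 volume) :
    MemLp (unweighted v a u) 2 volume := by
  have exp_mul : ∀ s, unweighted v a u s =
      ((Real.exp (-(a - ω) * |s|) : ℝ) : ℂ) * unweighted v ω u s := fun s => by
    rw [unweighted, unweighted, ← mul_assoc, ← Complex.ofReal_mul, mul_div_assoc', ← Real.exp_add]
    ring_nf
  rw [funext exp_mul]
  refine hu.mono ((Continuous.aestronglyMeasurable (by fun_prop)).mul hu.1)
    (Filter.Eventually.of_forall fun s => ?_)
  rw [norm_mul, Complex.norm_real, Real.norm_of_nonneg (Real.exp_pos _).le]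
  exact mul_le_of_le_one_left (norm_nonneg _) (Real.exp_le_one_iff.2
    (mul_nonpos_of_nonpos_of_nonneg (by linarith) (abs_nonneg s)))

theorem StronglyAdmissible.memLp_unweighted_of_norm_le (hv : StronglyAdmissible v) {C : ℝ}
    (hum : AEStronglyMeasurable u volume) (hu : ∀ s, ‖u s‖ ≤ C * Real.exp (ω * |s|)) :
    MemLp (unweighted v ω u) 2 volume := by
  have := hv.measurable
  refine (hv.memLp_inv.const_mul C).mono'
    ((Measurable.aestronglyMeasurable (by fun_prop)).mul hum)
    (Filter.Eventually.of_forall fun s => ?_)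
  have hvs := hv.pos s
  rw [unweighted, norm_mul, Complex.norm_real, Real.norm_of_nonneg (by positivity)]
  calc Real.exp (-ω * |s|) / v s * ‖u s‖
      ≤ Real.exp (-ω * |s|) / v s * (C * Real.exp (ω * |s|)) := by gcongr; exact hu s
    _ = C * (v s)⁻¹ := by
        rw [neg_mul, Real.exp_neg]
        field_simp

theorem StronglyAdmissible.memWeightedL2_iff (hv : StronglyAdmissible v) (hω : 0 ≤ ω) :
    MemWeightedL2 v ω g ↔ MemLp (weighted v ω g) 2 volume := by
  refine ⟨And.right, fun hg => ⟨?_, hg⟩⟩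
  have := hv.measurable
  rw [← hv.unweighted_weighted (ω := ω) g]
  exact hg.mono ((Measurable.aestronglyMeasurable (by fun_prop)).mul hg.1)
    (Filter.Eventually.of_forall (hv.norm_unweighted_le hω _))

theorem StronglyAdmissible.memWeightedL2_unweighted (hv : StronglyAdmissible v) (hω : 0 ≤ ω)
    (hu : MemLp u 2 volume) : MemWeightedL2 v ω (unweighted v ω u) :=
  (hv.memWeightedL2_iff hω).2 (by rwa [hv.weighted_unweighted])

namespace MemWeightedL2

theorem sub (hg : MemWeightedL2 v ω g) (hh : MemWeightedL2 v ω h) :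
    MemWeightedL2 v ω (g - h) := by
  rw [sub_eq_add_neg, ← neg_one_smul ℂ h]
  exact hg.add (hh.smul _)

theorem norm (hv : StronglyAdmissible v) (hω : 0 ≤ ω) (hg : MemWeightedL2 v ω g) :
    MemWeightedL2 v ω fun s => (‖g s‖ : ℂ) := by
  refine (hv.memWeightedL2_iff hω).2 (hg.2.mono ?_ ?_)
  · have := hv.measurable
    exact (Measurable.aestronglyMeasurable (by fun_prop)).mul hg.1.norm.ofReal.1
  · exact Filter.Eventually.of_forall fun s => by simp [weighted]

theorem integrable (hv : StronglyAdmissible v) (hω : 0 ≤ ω) (hg : MemWeightedL2 v ω g) :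
    Integrable g := by
  simpa using hg.integrable_kernel hv ⟨0, by simpa using hω⟩

theorem integrable_mul (hv : StronglyAdmissible v) (hg : MemWeightedL2 v ω g)
    (hu : MemLp (unweighted v ω u) 2 volume) : Integrable fun s => g s * u s := by
  simpa only [Pi.mul_def, hv.weighted_mul_unweighted] using hg.2.integrable_mul hu

theorem norm_integral_mul_le (hv : StronglyAdmissible v) (hg : MemWeightedL2 v ω g)
    (hu : MemLp (unweighted v ω u) 2 volume) :
    ‖∫ s, g s * u s‖ ≤
      weightedL2Norm v ω g * (eLpNorm (unweighted v ω u) 2 volume).toReal := by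
  simpa only [hv.weighted_mul_unweighted, weightedL2Norm] using
    SobolevCalculus.norm_integral_mul_le hg.2 hu

theorem weightedL2Norm_sub_le (hf : MemWeightedL2 v ω f) (hg : MemWeightedL2 v ω g)
    (hh : MemWeightedL2 v ω h) :
    weightedL2Norm v ω (f - g) ≤ weightedL2Norm v ω (h - f) + weightedL2Norm v ω (h - g) := by
  have hsub : weighted v ω (f - g) = weighted v ω (h - g) - weighted v ω (h - f) := by
    rw [← weighted_sub, sub_sub_sub_cancel_left]
  rw [weightedL2Norm, weightedL2Norm, weightedL2Norm, hsub, add_comm,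
    ← ENNReal.toReal_add (hh.sub hg).2.2.ne (hh.sub hf).2.2.ne]
  exact ENNReal.toReal_mono (ENNReal.add_ne_top.2 ⟨(hh.sub hg).2.2.ne, (hh.sub hf).2.2.ne⟩)
    (eLpNorm_sub_le (hh.sub hg).2.1 (hh.sub hf).2.1 one_le_two)

theorem integrable_convolution_mul (hv : StronglyAdmissible v) (hω : 0 ≤ ω)
    (hg : MemWeightedL2 v ω g) (hh : MemWeightedL2 v ω h) (hu : AEStronglyMeasurable u volume)
    (hu' : MemLp (unweighted v ω u) 2 volume) :
    Integrable (fun p : ℝ × ℝ => g p.2 * h (p.1 - p.2) * u p.1) (volume.prod volume) := by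
  have hgi := hg.integrable hv hω
  have hhi := hh.integrable hv hω
  have inner_norm : ∀ r, (((fun s => (‖g s‖ : ℂ)) ⋆[ContinuousLinearMap.mul ℝ ℂ, volume]
      fun s => (‖h s‖ : ℂ)) r) = ((∫ s, ‖g s‖ * ‖h (r - s)‖ : ℝ) : ℂ) := fun r => by
    rw [convolution_def, ← integral_complex_ofReal]
    simp
  have hmeas : AEStronglyMeasurable (fun p : ℝ × ℝ => g p.2 * h (p.1 - p.2) * u p.1)
      (volume.prod volume) :=
    (hgi.aestronglyMeasurable.convolution_integrand (ContinuousLinearMap.mul ℝ ℂ)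
      hhi.aestronglyMeasurable).mul hu.comp_fst
  refine (integrable_prod_iff hmeas).2 ⟨?_, ?_⟩
  · filter_upwards [hgi.ae_convolution_exists (ContinuousLinearMap.mul ℝ ℂ) hhi] with r hr
    exact Integrable.mul_const hr _
  · refine (((hg.norm hv hω).convolution hv hω (hh.norm hv hω)).integrable_mul hv hu').norm.congr
      (Filter.Eventually.of_forall fun r => ?_)
    simp only [norm_mul, inner_norm, integral_mul_const, Complex.norm_real]
    rw [Real.norm_of_nonneg (integral_nonneg fun s => by positivity)]

end MemWeightedL2

theorem memWeightedL2_resolventKernel (hv : StronglyAdmissible v) (hω : 0 ≤ ω)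
    (hl : ω < |l.im|) : MemWeightedL2 v ω (resolventKernel l) := by
  have := hv.measurable
  refine (hv.memWeightedL2_iff hω).2 ((hv.memLp_exp_mul (sub_pos.2 hl)).mono
    (Measurable.aestronglyMeasurable ?_) (Filter.Eventually.of_forall fun s => ?_))
  · exact Measurable.mul (by fun_prop) measurable_resolventKernel
  · rw [weighted, norm_mul, Complex.norm_real, Real.norm_of_nonneg
      (mul_pos (Real.exp_pos _) (hv.pos s)).le, Real.norm_of_nonneg
      (mul_pos (Real.exp_pos _) (hv.pos s)).le]
    calc Real.exp (ω * |s|) * v s * ‖resolventKernel l s‖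
        ≤ Real.exp (ω * |s|) * v s * Real.exp (-|l.im| * |s|) :=
          mul_le_mul_of_nonneg_left (norm_resolventKernel_le l s)
            (mul_pos (Real.exp_pos _) (hv.pos s)).le
      _ = Real.exp (-(|l.im| - ω) * |s|) * v s := by
          rw [mul_right_comm, ← Real.exp_add]
          ring_nf

theorem isInvFourier_resolventKernel (hv : StronglyAdmissible v) (hω : 0 ≤ ω)
    (hl : ω < |l.im|) :
    IsInvFourier v ω (fun z : ClosedStrip ω => (l - z)⁻¹) (resolventKernel l) :=
  ⟨memWeightedL2_resolventKernel hv hω hl, funext fun z => (stripFourier_resolventKernel hl z).symm⟩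

end WeightedSpace

section Totality

variable {v : ℝ → ℝ} {ω : ℝ} {u : ℝ → ℂ}

theorem isInvFourier_zero : IsInvFourier v ω 0 0 :=
  ⟨memWeightedL2_zero, by funext z; simp [stripFourier]⟩

theorem resolventKernel_sub_resolventKernel {b : ℝ} (hb : 0 < b) (ξ s : ℝ) :
    resolventKernel (ξ + b * Complex.I) s - resolventKernel (ξ - b * Complex.I) s =
      -Complex.I * Complex.exp (Complex.I * ξ * s) * Real.exp (-b * |s|) := by
  have hpos : 0 < (ξ + b * Complex.I : ℂ).im := by simpa using hb
  have hneg : ¬0 < (ξ - b * Complex.I : ℂ).im := by simpa using hb.le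
  rw [resolventKernel, resolventKernel, if_pos hpos, if_neg hneg]
  rcases lt_or_ge 0 s with hs | hs
  · rw [Set.indicator_of_mem (Set.mem_Ioi.2 hs), Set.indicator_of_notMem (by simpa using hs),
      sub_zero, abs_of_pos hs, Complex.ofReal_exp, mul_assoc (-Complex.I), ← Complex.exp_add]
    congr 2
    push_cast
    linear_combination (b * s) * Complex.I_mul_I
  · rw [Set.indicator_of_notMem (by simpa using hs), Set.indicator_of_mem (Set.mem_Iic.2 hs),
      zero_sub, abs_of_nonpos hs, Complex.ofReal_exp, mul_assoc (-Complex.I), ← Complex.exp_add,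
      neg_mul]
    congr 3
    push_cast
    linear_combination -(b * s) * Complex.I_mul_I

theorem memWeightedL2_exp_mul (hv : StronglyAdmissible v)
    (hu : MemLp (unweighted v ω u) 2 volume) :
    MemWeightedL2 v 0 fun s => Real.exp (-(ω + 1) * |s|) * u s := by
  have := hv.measurable
  obtain ⟨C, hC⟩ := hv.exists_le_exp one_half_pos
  have hweight : ∀ s, weighted v 0 (fun s => Real.exp (-(ω + 1) * |s|) * u s) s =
      ((v s ^ 2 * Real.exp (-|s|) : ℝ) : ℂ) * unweighted v ω u s := fun s => by
    have := (hv.pos s).ne'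
    rw [weighted, unweighted, ← mul_assoc, ← mul_assoc, ← Complex.ofReal_mul, ← Complex.ofReal_mul,
      zero_mul, Real.exp_zero, one_mul, show -(ω + 1) * |s| = -|s| + -ω * |s| by ring, Real.exp_add]
    congr 2
    field_simp
  refine (hv.memWeightedL2_iff le_rfl).2 (hu.of_le_mul (c := C ^ 2) ?_
    (Filter.Eventually.of_forall fun s => ?_))
  · rw [funext hweight]
    exact (Measurable.aestronglyMeasurable (by fun_prop)).mul hu.1
  · rw [hweight, norm_mul, Complex.norm_real, Real.norm_of_nonneg (by positivity)]
    refine mul_le_mul_of_nonneg_right ?_ (norm_nonneg _)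
    calc v s ^ 2 * Real.exp (-|s|)
        ≤ (C * Real.exp (1 / 2 * |s|)) ^ 2 * Real.exp (-|s|) := by
          have := (hv.pos s).le
          gcongr
          exact hC s
      _ = C ^ 2 := by
          rw [mul_pow, ← Real.exp_nat_mul, mul_assoc, ← Real.exp_add]
          simp

/-- Differences of kernels with conjugate parameters give the Fourier transform of
`exp (-(ω + 1) |s|) u`. -/
theorem ae_eq_zero_of_integral_resolventKernel_mul_eq_zero (hv : StronglyAdmissible v)
    (hω : 0 ≤ ω) (hu : MemLp (unweighted v ω u) 2 volume)
    (h : ∀ l : ℂ, ω < |l.im| → ∫ s, resolventKernel l s * u s = 0) : u =ᵐ[volume] 0 := by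
  have hb : 0 < ω + 1 := by linarith
  have transform_eq_zero : stripFourier 0 (fun s => Real.exp (-(ω + 1) * |s|) * u s) = 0 := by
    funext z
    obtain ⟨ξ, hξ⟩ : ∃ ξ : ℝ, (z : ℂ) = -ξ :=
      ⟨-(z : ℂ).re, Complex.ext (by simp) (by simpa using abs_nonpos_iff.1 z.2)⟩
    have hpos : ω < |(ξ + (ω + 1 : ℝ) * Complex.I : ℂ).im| := by simp [abs_of_pos hb]
    have hneg : ω < |(ξ - (ω + 1 : ℝ) * Complex.I : ℂ).im| := by
      simp only [Complex.sub_im, Complex.ofReal_im, Complex.im_ofReal_mul, Complex.I_im, mul_one,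
        zero_sub, abs_neg, abs_of_pos hb, lt_add_one]
    have hint := fun {l : ℂ} (hl : ω < |l.im|) =>
      (memWeightedL2_resolventKernel hv hω hl).integrable_mul hv hu
    refine (mul_eq_zero.1 ?_).resolve_left (neg_ne_zero.2 Complex.I_ne_zero)
    calc -Complex.I * stripFourier 0 (fun s => Real.exp (-(ω + 1) * |s|) * u s) z
        = ∫ s, resolventKernel (ξ + (ω + 1 : ℝ) * Complex.I) s * u s -
            resolventKernel (ξ - (ω + 1 : ℝ) * Complex.I) s * u s := by
          rw [stripFourier, ← integral_const_mul]
          congr 1 with s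
          rw [← sub_mul, resolventKernel_sub_resolventKernel hb, hξ]
          ring_nf
      _ = 0 := by rw [integral_sub (hint hpos) (hint hneg), h _ hpos, h _ hneg, sub_zero]
  filter_upwards [IsInvFourier.ae_eq hv le_rfl
    ⟨memWeightedL2_exp_mul hv hu, transform_eq_zero.symm⟩ isInvFourier_zero] with s hs
  exact (mul_eq_zero.1 hs).resolve_left (Complex.ofReal_ne_zero.2 (Real.exp_ne_zero _))

end Totality

/-! ### Growth of `C₀`-groups and Laplace transforms of orbits -/

section Groups

variable {X : Type*} [NormedAddCommGroup X] [NormedSpace ℂ X] {U : C0Group X} {A : X →ₗ.[ℂ] X}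
  {C a : ℝ} {l : ℂ}

namespace C0Group

theorem apply_add (U : C0Group X) (s t : ℝ) (x : X) : U (s + t) x = U s (U t x) := by
  rw [U.map_add]; rfl

theorem apply_zero (U : C0Group X) (x : X) : U 0 x = x := by
  rw [U.map_zero]; rfl

theorem map_nsmul (U : C0Group X) (n : ℕ) (t : ℝ) : U (n • t) = U t ^ n := by
  induction n with
  | zero => rw [zero_nsmul, U.map_zero, pow_zero]; rfl
  | succ n ih => rw [succ_nsmul, U.map_add, ih, pow_succ]; rfl

theorem norm_le_pow_of_abs_le {K : ℝ} (hK : ∀ s : ℝ, |s| ≤ 1 → ‖U s‖ ≤ K) (n : ℕ) {s : ℝ}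
    (hs : |s| ≤ n + 1) : ‖U s‖ ≤ K ^ (n + 1) := by
  have hn : (0 : ℝ) < (n + 1 : ℕ) := Nat.cast_pos.2 n.succ_pos
  have hsn : |s / (n + 1 : ℕ)| ≤ 1 := by
    rw [abs_div, abs_of_pos hn, div_le_one hn]
    exact_mod_cast hs
  have hpow : U s = U (s / (n + 1 : ℕ)) ^ (n + 1) := by
    rw [← U.map_nsmul, nsmul_eq_mul, mul_div_cancel₀ s hn.ne']
  rw [hpow]
  exact (norm_pow_le' _ n.succ_pos).trans (pow_le_pow_left₀ (norm_nonneg _) (hK _ hsn) _)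

theorem exists_norm_le_exp [CompleteSpace X] (U : C0Group X) :
    ∃ C a : ℝ, ∀ s, ‖U s‖ ≤ C * Real.exp (a * |s|) := by
  obtain ⟨M, hM⟩ := banach_steinhaus (g := fun s : Set.Icc (-1 : ℝ) 1 => U s) fun x =>
    let ⟨C, hC⟩ := isCompact_Icc.exists_bound_of_continuousOn (U.continuous x).continuousOn
    ⟨C, fun s => hC s s.2⟩
  obtain ⟨K, hK1, hK⟩ : ∃ K : ℝ, 1 ≤ K ∧ ∀ s : ℝ, |s| ≤ 1 → ‖U s‖ ≤ K :=
    ⟨max M 1, le_max_right _ _, fun s hs => (hM ⟨s, abs_le.1 hs⟩).trans (le_max_left _ _)⟩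
  refine ⟨K, Real.log K, fun s => ?_⟩
  calc ‖U s‖ ≤ K ^ (⌊|s|⌋₊ + 1) := norm_le_pow_of_abs_le hK _ (Nat.lt_floor_add_one |s|).le
    _ = K * K ^ (⌊|s|⌋₊ : ℝ) := by rw [pow_succ', Real.rpow_natCast]
    _ ≤ K * K ^ |s| := by gcongr; exact Nat.floor_le (abs_nonneg s)
    _ = K * Real.exp (Real.log K * |s|) := by
        rw [Real.rpow_def_of_pos (zero_lt_one.trans_le hK1)]

theorem integrable_resolventKernel_smul (hU : ∀ s, ‖U s‖ ≤ C * Real.exp (a * |s|))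
    (hl : a < |l.im|) (x : X) : Integrable fun s => resolventKernel l s • U s x :=
  SobolevCalculus.integrable_resolventKernel_smul (C := C * ‖x‖) hl
    (U.continuous x).aestronglyMeasurable fun s =>
      ((U s).le_of_opNorm_le (hU s) x).trans_eq (mul_right_comm _ _ _)

theorem apply_integral_Ioi_exp_smul [CompleteSpace X] {x : X}
    (hint : IntegrableOn (fun t : ℝ => Complex.exp (Complex.I * l * t) • U t x) (Set.Ioi 0))
    (s : ℝ) :
    U s (∫ t in Set.Ioi (0 : ℝ), Complex.exp (Complex.I * l * t) • U t x) =
      Complex.exp (Complex.I * -l * s) •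
        ((∫ t in Set.Ioi (0 : ℝ), Complex.exp (Complex.I * l * t) • U t x) -
          ∫ t in (0 : ℝ)..s, Complex.exp (Complex.I * l * t) • U t x) := by
  set φ : ℝ → X := fun t => Complex.exp (Complex.I * l * t) • U t x
  have hφ : Continuous φ := Continuous.smul (by fun_prop) (U.continuous x)
  have hφs : IntegrableOn φ (Set.Ioi s) :=
    ((hφ.integrableOn_Icc (a := s) (b := 0)).union hint).mono_set fun t ht =>
      (le_or_gt t 0).imp (fun h => ⟨ht.le, h⟩) id
  have shift : ∀ t, U s (φ t) = Complex.exp (Complex.I * -l * s) • φ (t + s) := fun t => by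
    simp only [φ]
    rw [map_smul, ← U.apply_add, smul_smul, ← Complex.exp_add, add_comm s]
    congr 2
    push_cast
    ring
  calc U s (∫ t in Set.Ioi (0 : ℝ), φ t)
      = Complex.exp (Complex.I * -l * s) • ∫ t in Set.Ioi (0 : ℝ), φ (t + s) := by
        rw [← ContinuousLinearMap.integral_comp_comm _ hint]
        simp only [shift, integral_smul]
    _ = Complex.exp (Complex.I * -l * s) • ∫ t in Set.Ioi s, φ t := by
        rw [← (measurePreserving_add_right volume s).setIntegral_preimage_emb
          (measurableEmbedding_addRight s) φ, Set.preimage_add_const_Ioi, sub_self]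
    _ = _ := by
        rw [← intervalIntegral.integral_interval_add_Ioi' (hφ.intervalIntegrable 0 s) hφs,
          add_sub_cancel_left]

theorem hasDerivAt_apply_integral_Ioi_exp_smul [CompleteSpace X] {x : X}
    (hint : IntegrableOn (fun t : ℝ => Complex.exp (Complex.I * l * t) • U t x) (Set.Ioi 0)) :
    HasDerivAt (fun s => U s (∫ t in Set.Ioi (0 : ℝ), Complex.exp (Complex.I * l * t) • U t x))
      (-(Complex.I * l) • (∫ t in Set.Ioi (0 : ℝ), Complex.exp (Complex.I * l * t) • U t x) - x)
      0 := by
  have hφ : Continuous fun t : ℝ => Complex.exp (Complex.I * l * t) • U t x :=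
    Continuous.smul (by fun_prop) (U.continuous x)
  have hderiv := hasDerivAt_exp_smul (-l)
    ((hφ.integral_hasStrictDerivAt 0 0).hasDerivAt.const_sub
      (∫ t in Set.Ioi (0 : ℝ), Complex.exp (Complex.I * l * t) • U t x))
  simp only [apply_integral_Ioi_exp_smul hint]
  refine hderiv.congr_deriv ?_
  simp only [Complex.ofReal_zero, mul_zero, Complex.exp_zero, one_smul, U.apply_zero,
    intervalIntegral.integral_same, sub_zero]
  linear_combination (norm := module) Complex.I_mul_I • x

end C0Group

theorem hasDerivAt_orbit_zero (hA : (-Complex.I) • A = U.generator) (y : A.domain) :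
    HasDerivAt (fun s => U s (y : X)) (-Complex.I • A y) 0 := by
  have : ∀ B : X →ₗ.[ℂ] X, (-Complex.I) • A = B →
      ∃ hy : (y : X) ∈ B.domain, B ⟨y, hy⟩ = -Complex.I • A y := by
    rintro _ rfl
    exact ⟨y.2, rfl⟩
  obtain ⟨hy, hval⟩ := this _ hA
  rw [← hval]
  exact DifferentiableAt.hasDerivAt hy

theorem exists_of_hasDerivAt_orbit_zero (hA : (-Complex.I) • A = U.generator) {x w : X}
    (h : HasDerivAt (fun s => U s x) w 0) :
    ∃ y : A.domain, (y : X) = x ∧ A y = Complex.I • w := by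
  have hdom : A.domain = U.generator.domain := by rw [← hA]; rfl
  have hx : x ∈ A.domain := by rw [hdom]; exact h.differentiableAt
  refine ⟨⟨x, hx⟩, rfl, ?_⟩
  rw [← (hasDerivAt_orbit_zero hA ⟨x, hx⟩).unique h, smul_smul]
  simp

theorem hasDerivAt_orbit (hA : (-Complex.I) • A = U.generator) (y : A.domain) (s : ℝ) :
    HasDerivAt (fun s => U s (y : X)) (-Complex.I • U s (A y)) s := by
  have hzero : HasDerivAt (fun t => U t (y : X)) (-Complex.I • A y) (s - s) := by
    rw [sub_self]
    exact hasDerivAt_orbit_zero hA y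
  have hshift := ((U s).restrictScalars ℝ).hasFDerivAt.comp_hasDerivAt s (hzero.comp_sub_const s s)
  refine (hshift.congr_deriv (map_smul (U s) _ _)).congr_of_eventuallyEq
    (Filter.Eventually.of_forall fun t => ?_)
  change U t (y : X) = U s (U (t - s) y)
  rw [← U.apply_add, add_sub_cancel]

variable [CompleteSpace X]

theorem integral_resolventKernel_smul_sub (hA : (-Complex.I) • A = U.generator)
    (hU : ∀ s, ‖U s‖ ≤ C * Real.exp (a * |s|)) (hl : a < |l.im|) (y : A.domain) :
    ∫ s, resolventKernel l s • U s (l • (y : X) - A y) = y := by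
  have hint := U.integrable_resolventKernel_smul hU hl
  have hparts := integral_resolventKernel_smul_sub_deriv (hasDerivAt_orbit hA y) (hint y)
    (by simpa only [map_smul] using hint (-Complex.I • A y))
  simpa [smul_smul, U.apply_zero] using hparts

theorem IsResolvent.apply_eq_integral (hA : (-Complex.I) • A = U.generator)
    (hU : ∀ s, ‖U s‖ ≤ C * Real.exp (a * |s|)) (hl : a < |l.im|) {R : X →L[ℂ] X}
    (hR : IsResolvent A l R) (x : X) : R x = ∫ s, resolventKernel l s • U s x := by
  obtain ⟨y, hy, hyx⟩ := hR.2 x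
  rw [← hy, ← integral_resolventKernel_smul_sub hA hU hl y, hyx]

theorem isResolvent_of_apply_eq_integral (hA : (-Complex.I) • A = U.generator)
    (hU : ∀ s, ‖U s‖ ≤ C * Real.exp (a * |s|)) (hl₀ : 0 < l.im) (hl : a < l.im) {R : X →L[ℂ] X}
    (hR : ∀ x, R x = ∫ s, resolventKernel l s • U s x) : IsResolvent A l R := by
  have hl' : a < |l.im| := hl.trans_le (le_abs_self _)
  refine ⟨fun y => by rw [hR, integral_resolventKernel_smul_sub hA hU hl'], fun x => ?_⟩
  have hint := U.integrable_resolventKernel_smul hU hl' x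
  rw [resolventKernel_smul_of_im_pos hl₀, integrable_indicator_iff measurableSet_Ioi] at hint
  set Y : X := ∫ t in Set.Ioi (0 : ℝ), Complex.exp (Complex.I * l * t) • U t x
  have hRx : R x = -Complex.I • Y := by
    rw [hR, resolventKernel_smul_of_im_pos hl₀, integral_indicator measurableSet_Ioi, integral_smul]
  have hderiv : HasDerivAt (fun s => U s (R x)) (-Complex.I • (-(Complex.I * l) • Y - x)) 0 := by
    simpa only [hRx, map_smul, Pi.smul_def] using (C0Group.hasDerivAt_apply_integral_Ioi_exp_smul
      ((integrable_smul_iff (neg_ne_zero.2 Complex.I_ne_zero) _).1 hint)).const_smul (-Complex.I)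
  obtain ⟨y, hy, hAy⟩ := exists_of_hasDerivAt_orbit_zero hA hderiv
  refine ⟨y, hy, ?_⟩
  rw [hAy, hy, hRx]
  simp only [smul_sub, smul_smul]
  linear_combination (norm := module) -Complex.I_mul_I • (x + (l * Complex.I) • Y)

end Groups

/-! ### Weak orbit integrals -/

section OrbitIntegrals

variable {X : Type*} [NormedAddCommGroup X] [NormedSpace ℂ X] {U : C0Group X} {v : ℝ → ℝ} {ω : ℝ}
  {g h : ℝ → ℂ}

/-- `T` is the weak integral `∫ g(s) U_s ds`. -/
def IsOrbitIntegral (U : C0Group X) (g : ℝ → ℂ) (T : X →L[ℂ] X) : Prop :=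
  ∀ (x : X) (x' : StrongDual ℂ X), Integrable (fun s => g s * x' (U s x)) ∧
    x' (T x) = ∫ s, g s * x' (U s x)

namespace IsOrbitIntegral

variable {S T : X →L[ℂ] X}

theorem unique (hT : IsOrbitIntegral U g T) (hS : IsOrbitIntegral U g S) : T = S := by
  ext x
  refine SeparatingDual.eq_iff_forall_dual_eq (R := ℂ).2 fun x' => ?_
  rw [(hT x x').2, (hS x x').2]

theorem congr (hT : IsOrbitIntegral U g T) (hgh : g =ᵐ[volume] h) : IsOrbitIntegral U h T := by
  intro x x'
  have hae : (fun s => g s * x' (U s x)) =ᵐ[volume] fun s => h s * x' (U s x) :=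
    hgh.mul (Filter.EventuallyEq.refl _ _)
  exact ⟨(hT x x').1.congr hae, (hT x x').2.trans (integral_congr_ae hae)⟩

theorem add (hT : IsOrbitIntegral U g T) (hS : IsOrbitIntegral U h S) :
    IsOrbitIntegral U (g + h) (T + S) := by
  intro x x'
  simp only [Pi.add_apply, add_mul, _root_.add_apply, map_add]
  exact ⟨(hT x x').1.add (hS x x').1, by
    rw [(hT x x').2, (hS x x').2, integral_add (hT x x').1 (hS x x').1]⟩

theorem smul (c : ℂ) (hT : IsOrbitIntegral U g T) : IsOrbitIntegral U (c • g) (c • T) := by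
  intro x x'
  simp only [Pi.smul_apply, smul_eq_mul, mul_assoc, _root_.smul_apply, map_smul]
  exact ⟨(hT x x').1.const_mul c, by rw [(hT x x').2, integral_const_mul]⟩

theorem sub (hT : IsOrbitIntegral U g T) (hS : IsOrbitIntegral U h S) :
    IsOrbitIntegral U (g - h) (T - S) := by
  simpa only [neg_one_smul, ← sub_eq_add_neg] using hT.add (hS.smul (-1))

theorem convolution (hv : StronglyAdmissible v) (hω : 0 ≤ ω)
    (hU : ∀ (x : X) (x' : StrongDual ℂ X), MemLp (unweighted v ω fun s => x' (U s x)) 2 volume)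
    (hg : MemWeightedL2 v ω g) (hh : MemWeightedL2 v ω h)
    (hT : IsOrbitIntegral U g T) (hS : IsOrbitIntegral U h S) :
    IsOrbitIntegral U (g ⋆[ContinuousLinearMap.mul ℝ ℂ, volume] h) (T * S) := by
  refine fun x x' => ⟨(hg.convolution hv hω hh).integrable_mul hv (hU x x'), ?_⟩
  have hu : Continuous fun s => x' (U s x) := x'.continuous.comp (U.continuous x)
  have inner : ∀ s, x' (U s (S x)) = ∫ t, h t * x' (U (s + t) x) := fun s => by
    simp only [U.apply_add]
    exact (hS x (x'.comp (U s))).2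
  calc x' ((T * S) x) = ∫ s, g s * x' (U s (S x)) := (hT (S x) x').2
    _ = ∫ s, g s * ∫ t, h t * x' (U (s + t) x) := by simp only [inner]
    _ = ∫ r, (g ⋆[ContinuousLinearMap.mul ℝ ℂ, volume] h) r * x' (U r x) :=
        (integral_convolution_mul
          (hg.integrable_convolution_mul hv hω hh hu.aestronglyMeasurable (hU x x'))).symm

section CompleteSpace

variable [CompleteSpace X]

theorem exists_norm_le (hv : StronglyAdmissible v)
    (hU : ∀ (x : X) (x' : StrongDual ℂ X), MemLp (unweighted v ω fun s => x' (U s x)) 2 volume) :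
    ∃ C, ∀ g T, MemWeightedL2 v ω g → IsOrbitIntegral U g T → ‖T‖ ≤ C * weightedL2Norm v ω g := by
  obtain ⟨C, hC⟩ := exists_norm_le_mul_of_forall_dual
    (ι := {p : (ℝ → ℂ) × (X →L[ℂ] X) // MemWeightedL2 v ω p.1 ∧ IsOrbitIntegral U p.1 p.2})
    (T := fun p => p.1.2) (r := fun p => weightedL2Norm v ω p.1.1)
    (N := fun x x' => (eLpNorm (unweighted v ω fun s => x' (U s x)) 2 volume).toReal)
    (fun _ => ENNReal.toReal_nonneg) fun p x x' => by
      rw [(p.2.2 x x').2]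
      exact p.2.1.norm_integral_mul_le hv (hU x x')
  exact ⟨C, fun g T hg hT => hC ⟨(g, T), hg, hT⟩⟩

theorem exists_of_integrable_exp {C a : ℝ} (hU : ∀ s, ‖U s‖ ≤ C * Real.exp (a * |s|))
    (hgm : AEStronglyMeasurable g volume)
    (hg : Integrable fun s => ((Real.exp (a * |s|) : ℝ) : ℂ) * g s) :
    ∃ T, IsOrbitIntegral U g T := by
  have hle : ∀ x s, ‖g s • U s x‖ ≤ ‖((Real.exp (a * |s|) : ℝ) : ℂ) * g s‖ * C * ‖x‖ := by
    intro x s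
    rw [norm_smul, norm_mul, Complex.norm_real, Real.norm_of_nonneg (Real.exp_pos _).le]
    calc ‖g s‖ * ‖U s x‖ ≤ ‖g s‖ * (C * Real.exp (a * |s|) * ‖x‖) := by
          gcongr; exact (U s).le_of_opNorm_le (hU s) x
      _ = _ := by ring
  have hbound : ∀ x : X, Integrable fun s => ‖((Real.exp (a * |s|) : ℝ) : ℂ) * g s‖ * C * ‖x‖ :=
    fun x => (hg.norm.mul_const C).mul_const _
  have hint : ∀ x, Integrable fun s => g s • U s x := fun x =>
    (hbound x).mono' (hgm.smul (U.continuous x).aestronglyMeasurable)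
      (Filter.Eventually.of_forall (hle x))
  let T : X →ₗ[ℂ] X :=
    { toFun := fun x => ∫ s, g s • U s x
      map_add' := fun x y => by
        simp only [map_add, smul_add, integral_add (hint x) (hint y)]
      map_smul' := fun c x => by
        simp only [map_smul, RingHom.id_apply, smul_comm _ c, integral_smul] }
  refine ⟨T.mkContinuous (∫ s, ‖((Real.exp (a * |s|) : ℝ) : ℂ) * g s‖ * C) fun x => ?_,
    fun x x' => ⟨?_, ?_⟩⟩
  · rw [← integral_mul_const]
    exact norm_integral_le_of_norm_le (hbound x) (Filter.Eventually.of_forall (hle x))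
  · simpa only [map_smul, smul_eq_mul] using x'.integrable_comp (hint x)
  · change x' (∫ s, g s • U s x) = _
    simpa only [map_smul, smul_eq_mul] using (x'.integral_comp_comm (hint x)).symm

theorem exists_of_tendsto (hv : StronglyAdmissible v)
    (hU : ∀ (x : X) (x' : StrongDual ℂ X), MemLp (unweighted v ω fun s => x' (U s x)) 2 volume)
    (hg : MemWeightedL2 v ω g) {f : ℕ → ℝ → ℂ} {T : ℕ → X →L[ℂ] X}
    (hf : ∀ n, MemWeightedL2 v ω (f n)) (hT : ∀ n, IsOrbitIntegral U (f n) (T n))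
    (hlim : Filter.Tendsto (fun n => weightedL2Norm v ω (g - f n)) Filter.atTop (nhds 0)) :
    ∃ S, IsOrbitIntegral U g S := by
  obtain ⟨C, hC⟩ := exists_norm_le hv hU
  have hcauchy : CauchySeq T := by
    have hlim₂ : Filter.Tendsto (fun p : ℕ × ℕ => |C| *
        (weightedL2Norm v ω (g - f p.1) + weightedL2Norm v ω (g - f p.2)))
        Filter.atTop (nhds 0) := by
      rw [← Filter.prod_atTop_atTop_eq]
      simpa using ((hlim.comp Filter.tendsto_fst).add
        (hlim.comp Filter.tendsto_snd)).const_mul (|C|)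
    refine cauchySeq_iff_tendsto_dist_atTop_0.2 (squeeze_zero (fun _ => dist_nonneg)
      (fun p => ?_) hlim₂)
    calc dist (T p.1) (T p.2) ≤ C * weightedL2Norm v ω (f p.1 - f p.2) := by
          rw [dist_eq_norm]
          exact hC _ _ ((hf _).sub (hf _)) ((hT _).sub (hT _))
      _ ≤ |C| * weightedL2Norm v ω (f p.1 - f p.2) :=
          mul_le_mul_of_nonneg_right (le_abs_self C) ENNReal.toReal_nonneg
      _ ≤ _ := by gcongr; exact (hf _).weightedL2Norm_sub_le (hf _) hg
  obtain ⟨S, hS⟩ := cauchySeq_tendsto_of_complete hcauchy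
  refine ⟨S, fun x x' => ⟨hg.integrable_mul hv (hU x x'), ?_⟩⟩
  have hlim_left : Filter.Tendsto (fun n => x' (T n x)) Filter.atTop (nhds (x' (S x))) :=
    (x'.comp (ContinuousLinearMap.apply ℂ X x)).continuous.continuousAt.tendsto.comp hS
  have hlim_right : Filter.Tendsto (fun n => x' (T n x)) Filter.atTop
      (nhds (∫ s, g s * x' (U s x))) := by
    have hlim_mul := hlim.mul_const (eLpNorm (unweighted v ω fun s => x' (U s x)) 2 volume).toReal
    rw [zero_mul] at hlim_mul
    refine tendsto_iff_norm_sub_tendsto_zero.2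
      (squeeze_zero (fun _ => norm_nonneg _) (fun n => ?_) hlim_mul)
    rw [norm_sub_rev, (hT n x x').2,
      ← integral_sub (hg.integrable_mul hv (hU x x')) (hT n x x').1]
    simpa only [Pi.sub_apply, sub_mul] using
      (hg.sub (hf n)).norm_integral_mul_le hv (hU x x')
  exact tendsto_nhds_unique hlim_left hlim_right

theorem exists_weightedL2Norm_sub_le (hv : StronglyAdmissible v) (hω : 0 ≤ ω)
    (hg : MemWeightedL2 v ω g) {ε : ℝ} (hε : 0 < ε) :
    ∃ f T, MemWeightedL2 v ω f ∧ IsOrbitIntegral U f T ∧ weightedL2Norm v ω (g - f) ≤ ε := by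
  obtain ⟨C, a, hCa⟩ := U.exists_norm_le_exp
  obtain ⟨φ, hφc, hφ, hφcont, hφ2⟩ := hg.2.exists_hasCompactSupport_eLpNorm_sub_le
    ENNReal.ofNat_ne_top (ENNReal.ofReal_pos.2 hε).ne'
  have hf := hv.memWeightedL2_unweighted hω hφ2
  have hφi : Integrable fun s => ((Real.exp (a * |s|) : ℝ) : ℂ) * φ s :=
    Continuous.integrable_of_hasCompactSupport (by fun_prop) hφc.mul_left
  obtain ⟨T, hT⟩ := exists_of_integrable_exp hCa hf.1.1 (hφi.mono
    ((Continuous.aestronglyMeasurable (by fun_prop)).mul hf.1.1)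
    (Filter.Eventually.of_forall fun s => by
      rw [norm_mul, norm_mul]
      gcongr
      exact hv.norm_unweighted_le hω φ s))
  refine ⟨unweighted v ω φ, T, hf, hT, ?_⟩
  rw [weightedL2Norm, weighted_sub, hv.weighted_unweighted]
  exact ENNReal.toReal_le_of_le_ofReal hε.le hφ

theorem exists_of_memWeightedL2 (hv : StronglyAdmissible v) (hω : 0 ≤ ω)
    (hU : ∀ (x : X) (x' : StrongDual ℂ X), MemLp (unweighted v ω fun s => x' (U s x)) 2 volume)
    (hg : MemWeightedL2 v ω g) : ∃ T, IsOrbitIntegral U g T := by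
  choose f T hf hT hfT using fun n : ℕ =>
    exists_weightedL2Norm_sub_le (U := U) hv hω hg (Nat.one_div_pos_of_nat (α := ℝ) (n := n))
  exact exists_of_tendsto hv hU hg hf hT
    (squeeze_zero (fun _ => ENNReal.toReal_nonneg) hfT tendsto_one_div_add_atTop_nhds_zero_nat)

end CompleteSpace

end IsOrbitIntegral

end OrbitIntegrals

/-! ### Bounded calculi -/

section Calculus

variable {v : ℝ → ℝ} {ω : ℝ} {f k : ClosedStrip ω → ℂ} {g h φ : ℝ → ℂ}

theorem IsInvFourier.add (hv : StronglyAdmissible v) (hg : IsInvFourier v ω f g)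
    (hh : IsInvFourier v ω k h) : IsInvFourier v ω (f + k) (g + h) := by
  refine ⟨hg.1.add hh.1, funext fun z => ?_⟩
  simp only [hg.2, hh.2, Pi.add_apply, stripFourier, mul_add]
  exact (integral_add (hg.1.integrable_kernel hv z) (hh.1.integrable_kernel hv z)).symm

theorem IsInvFourier.smul (c : ℂ) (hg : IsInvFourier v ω f g) :
    IsInvFourier v ω (c • f) (c • g) := by
  refine ⟨hg.1.smul c, funext fun z => ?_⟩
  simp only [hg.2, Pi.smul_apply, stripFourier, smul_eq_mul, ← integral_const_mul,
    mul_left_comm _ c]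

theorem IsInvFourier.mul (hv : StronglyAdmissible v) (hω : 0 ≤ ω) (hg : IsInvFourier v ω f g)
    (hh : IsInvFourier v ω k h) :
    IsInvFourier v ω (f * k) (g ⋆[ContinuousLinearMap.mul ℝ ℂ, volume] h) :=
  ⟨hg.1.convolution hv hω hh.1, by rw [hg.2, hh.2, stripFourier_convolution hv hg.1 hh.1]⟩

theorem IsInvFourier.congr (hg : IsInvFourier v ω f g) (hgh : g =ᵐ[volume] h) :
    IsInvFourier v ω f h :=
  ⟨⟨hg.1.1.ae_eq hgh, hg.1.2.ae_eq ((Filter.EventuallyEq.refl _ _).mul hgh)⟩,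
    hg.2.trans (funext fun _ =>
      integral_congr_ae ((Filter.EventuallyEq.refl _ _).mul hgh))⟩

theorem isInvFourier_stripFourier_unweighted (hv : StronglyAdmissible v) (hω : 0 ≤ ω)
    (hφ : MemLp φ 2 volume) :
    IsInvFourier v ω (stripFourier ω (unweighted v ω φ)) (unweighted v ω φ) :=
  ⟨hv.memWeightedL2_unweighted hω hφ, rfl⟩

/-- The isometric parametrization of `W²_v(St_ω)` by `L²(ℝ)`, which maps `φ` to the Fourier
transform of `exp (-ω |s|) φ / v`. -/
noncomputable def sobolevOfLp (hv : StronglyAdmissible v) (hω : 0 ≤ ω) :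
    Lp ℂ 2 (volume : Measure ℝ) →ₗ[ℂ] sobolevAlgebra hv hω where
  toFun φ := ⟨_, _, isInvFourier_stripFourier_unweighted hv hω (Lp.memLp φ)⟩
  map_add' φ ψ := Subtype.ext <| Eq.symm <| And.right <|
    ((isInvFourier_stripFourier_unweighted hv hω (Lp.memLp φ)).add hv
      (isInvFourier_stripFourier_unweighted hv hω (Lp.memLp ψ))).congr <| by
        rw [← unweighted_add]
        exact unweighted_congr_ae (Lp.coeFn_add φ ψ).symm
  map_smul' c φ := Subtype.ext <| Eq.symm <| And.right <|
    ((isInvFourier_stripFourier_unweighted hv hω (Lp.memLp φ)).smul c).congr <| by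
      rw [← unweighted_smul]
      exact unweighted_congr_ae (Lp.coeFn_smul c φ).symm

theorem isInvFourier_sobolevOfLp (hv : StronglyAdmissible v) (hω : 0 ≤ ω)
    (φ : Lp ℂ 2 (volume : Measure ℝ)) :
    IsInvFourier v ω (sobolevOfLp hv hω φ : ClosedStrip ω → ℂ) (unweighted v ω φ) :=
  isInvFourier_stripFourier_unweighted hv hω (Lp.memLp φ)

theorem sobolevOfLp_toLp_weighted {hv : StronglyAdmissible v} {hω : 0 ≤ ω}
    {f : sobolevAlgebra hv hω} (hg : IsInvFourier v ω (f : ClosedStrip ω → ℂ) g) :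
    sobolevOfLp hv hω (hg.1.2.toLp (weighted v ω g)) = f := by
  refine Subtype.ext (Eq.symm (hg.congr ?_).2)
  conv_lhs => rw [← hv.unweighted_weighted (ω := ω) g]
  exact unweighted_congr_ae hg.1.2.coeFn_toLp.symm

variable {X : Type*} [NormedAddCommGroup X] [NormedSpace ℂ X] {U : C0Group X} {A : X →ₗ.[ℂ] X}
  {l m : ℂ} {Q R T : X →L[ℂ] X}

theorem IsResolvent.of_resolvent_identity (hR : IsResolvent A l R)
    (hRQ : R = Q + (m - l) • (R * Q)) (hQR : R = Q + (m - l) • (Q * R)) : IsResolvent A m Q := by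
  have hRQ' : ∀ x, R x = Q x + (m - l) • R (Q x) := DFunLike.congr_fun hRQ
  have hQR' : ∀ x, R x = Q x + (m - l) • Q (R x) := DFunLike.congr_fun hQR
  have shift : ∀ y : A.domain, m • (y : X) - A y = (l • (y : X) - A y) + (m - l) • (y : X) :=
    fun y => by module
  refine ⟨fun y => ?_, fun x => ?_⟩
  · have := hQR' (l • (y : X) - A y)
    rw [hR.1 y] at this
    rw [shift, map_add, map_smul, ← this]
  · obtain ⟨y, hy, hyx⟩ := hR.2 (x - (m - l) • Q x)
    have hyQ : (y : X) = Q x := by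
      rw [hy, map_sub, map_smul, hRQ' x, add_sub_cancel_right]
    refine ⟨y, hyQ, ?_⟩
    rw [shift, hyx, hyQ, sub_add_cancel]

theorem MapsToResolvent.of_mapsToResolvent {hv : StronglyAdmissible v} {hω : 0 ≤ ω}
    {Ψ : sobolevAlgebra hv hω →ₙₐ[ℂ] (X →L[ℂ] X)} (hl : ω < |l.im|) (hm : ω < |m.im|)
    (h : MapsToResolvent hv hω A Ψ l) : MapsToResolvent hv hω A Ψ m := by
  obtain ⟨r, hr, hR⟩ := h
  let q : sobolevAlgebra hv hω := ⟨_, _, isInvFourier_resolventKernel hv hω hm⟩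
  have sub_ne_zero_of_lt : ∀ {n : ℂ}, ω < |n.im| → ∀ z : ClosedStrip ω, n - z ≠ 0 :=
    fun hn z h0 => not_le.2 hn (by rw [sub_eq_zero.1 h0]; exact z.2)
  have identity : r = q + (m - l) • (r * q) := by
    refine Subtype.ext (funext fun z => ?_)
    have hlz := sub_ne_zero_of_lt hl z
    have hmz := sub_ne_zero_of_lt hm z
    change (r : ClosedStrip ω → ℂ) z =
      (m - z)⁻¹ + (m - l) * ((r : ClosedStrip ω → ℂ) z * (m - z)⁻¹)
    rw [hr]
    field_simp
    ring
  refine ⟨q, fun _ => rfl, hR.of_resolvent_identity ?_ ?_⟩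
  · simpa only [map_add, map_smul, map_mul] using congrArg Ψ identity
  · simpa only [map_add, map_smul, map_mul, mul_comm r q] using congrArg Ψ identity

theorem IsBoundedSobolevCalculus.mapsToResolvent {hv : StronglyAdmissible v} {hω : 0 ≤ ω}
    {Ψ : sobolevAlgebra hv hω →ₙₐ[ℂ] (X →L[ℂ] X)} (hΨ : IsBoundedSobolevCalculus hv hω A Ψ)
    (hl : ω < |l.im|) : MapsToResolvent hv hω A Ψ l :=
  let ⟨_, hl₀, hres⟩ := hΨ.resolvent
  hres.of_mapsToResolvent hl₀ hl

theorem IsBoundedSobolevCalculus.exists_density {hv : StronglyAdmissible v} {hω : 0 ≤ ω}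
    {Ψ : sobolevAlgebra hv hω →ₙₐ[ℂ] (X →L[ℂ] X)} (hΨ : IsBoundedSobolevCalculus hv hω A Ψ)
    (x : X) (x' : StrongDual ℂ X) :
    ∃ u : ℝ → ℂ, MemLp (unweighted v ω u) 2 volume ∧
      ∀ (f : sobolevAlgebra hv hω) (g : ℝ → ℂ), IsInvFourier v ω (f : ClosedStrip ω → ℂ) g →
        x' (Ψ f x) = ∫ s, g s * u s := by
  obtain ⟨C, hC⟩ := hΨ.bounded
  let L : StrongDual ℂ (Lp ℂ 2 (volume : Measure ℝ)) :=
    LinearMap.mkContinuous ((x'.comp (ContinuousLinearMap.apply ℂ X x)).toLinearMap ∘ₗ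
      (Ψ : sobolevAlgebra hv hω →ₗ[ℂ] X →L[ℂ] X) ∘ₗ sobolevOfLp hv hω) (‖x'‖ * C * ‖x‖) fun φ => by
        have hφ := hC _ _ (isInvFourier_sobolevOfLp hv hω φ)
        rw [weightedL2Norm, hv.weighted_unweighted, ← Lp.norm_def] at hφ
        calc ‖x' (Ψ (sobolevOfLp hv hω φ) x)‖ ≤ ‖x'‖ * (C * ‖φ‖ * ‖x‖) :=
              x'.le_opNorm_of_le (ContinuousLinearMap.le_of_opNorm_le _ hφ x)
          _ = ‖x'‖ * C * ‖x‖ * ‖φ‖ := by ring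
  obtain ⟨ψ, hψ, hL⟩ := exists_memLp_forall_apply_eq_integral_mul L
  refine ⟨weighted v ω ψ, by rwa [hv.unweighted_weighted], fun f g hg => ?_⟩
  calc x' (Ψ f x) = L (hg.1.2.toLp (weighted v ω g)) := by
        conv_lhs => rw [← sobolevOfLp_toLp_weighted hg]
        rfl
    _ = ∫ s, weighted v ω g s * ψ s := by
        rw [hL]
        exact integral_congr_ae (hg.1.2.coeFn_toLp.mul (Filter.EventuallyEq.refl _ _))
    _ = ∫ s, g s * weighted v ω ψ s := by
        congr 1 with s
        simp only [weighted]
        ring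

variable [CompleteSpace X]

theorem IsResolvent.isOrbitIntegral (hA : (-Complex.I) • A = U.generator) {C a : ℝ}
    (hU : ∀ s, ‖U s‖ ≤ C * Real.exp (a * |s|)) (hl : a < |l.im|) (hR : IsResolvent A l R) :
    IsOrbitIntegral U (resolventKernel l) R := fun x x' => by
  have hint := U.integrable_resolventKernel_smul hU hl x
  refine ⟨by simpa only [map_smul, smul_eq_mul] using x'.integrable_comp hint, ?_⟩
  rw [hR.apply_eq_integral hA hU hl]
  simpa only [map_smul, smul_eq_mul] using (x'.integral_comp_comm hint).symm

theorem IsOrbitIntegral.isResolvent (hA : (-Complex.I) • A = U.generator) {C a : ℝ}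
    (hU : ∀ s, ‖U s‖ ≤ C * Real.exp (a * |s|)) (hl₀ : 0 < l.im) (hl : a < l.im)
    (hT : IsOrbitIntegral U (resolventKernel l) T) : IsResolvent A l T := by
  refine isResolvent_of_apply_eq_integral hA hU hl₀ hl fun x =>
    SeparatingDual.eq_iff_forall_dual_eq (R := ℂ).2 fun x' => ?_
  rw [(hT x x').2, ← x'.integral_comp_comm
    (U.integrable_resolventKernel_smul hU (hl.trans_le (le_abs_self _)) x)]
  simp only [map_smul, smul_eq_mul]

theorem exists_algHom_forall_isOrbitIntegral (hv : StronglyAdmissible v) (hω : 0 ≤ ω)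
    (hU : ∀ (x : X) (x' : StrongDual ℂ X), MemLp (unweighted v ω fun s => x' (U s x)) 2 volume) :
    ∃ Ψ : sobolevAlgebra hv hω →ₙₐ[ℂ] (X →L[ℂ] X), ∀ (f : sobolevAlgebra hv hω) (g : ℝ → ℂ),
      IsInvFourier v ω (f : ClosedStrip ω → ℂ) g → IsOrbitIntegral U g (Ψ f) := by
  have exists_operator : ∀ f : sobolevAlgebra hv hω, ∃ T : X →L[ℂ] X, ∀ g,
      IsInvFourier v ω (f : ClosedStrip ω → ℂ) g → IsOrbitIntegral U g T := by
    rintro ⟨f, g, hg⟩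
    obtain ⟨T, hT⟩ := IsOrbitIntegral.exists_of_memWeightedL2 hv hω hU hg.1
    exact ⟨T, fun k hk => hT.congr (hg.ae_eq hv hω hk)⟩
  choose Ψ hΨ using exists_operator
  refine ⟨{ toFun := Ψ, map_zero' := ?_, map_add' := ?_, map_smul' := ?_, map_mul' := ?_ }, hΨ⟩
  · rintro c ⟨f, g, hg⟩
    exact (hΨ _ _ (hg.smul c)).unique ((hΨ _ g hg).smul c)
  · exact (hΨ 0 0 isInvFourier_zero).unique fun x x' => by simp
  · rintro ⟨f, g, hg⟩ ⟨k, h, hh⟩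
    exact (hΨ _ _ (hg.add hv hh)).unique ((hΨ _ g hg).add (hΨ _ h hh))
  · rintro ⟨f, g, hg⟩ ⟨k, h, hh⟩
    exact (hΨ _ _ (hg.mul hv hω hh)).unique
      ((hΨ _ g hg).convolution hv hω hU hg.1 hh.1 (hΨ _ h hh))

theorem hasBoundedSobolevCalculus_of_memLp (hA : (-Complex.I) • A = U.generator)
    (hv : StronglyAdmissible v) (hω : 0 ≤ ω)
    (hU : ∀ (x : X) (x' : StrongDual ℂ X), MemLp (unweighted v ω fun s => x' (U s x)) 2 volume) :
    HasBoundedSobolevCalculus hv hω A := by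
  obtain ⟨Ψ, hΨ⟩ := exists_algHom_forall_isOrbitIntegral hv hω hU
  obtain ⟨K, hK⟩ := IsOrbitIntegral.exists_norm_le hv hU
  obtain ⟨C, a, hCa⟩ := U.exists_norm_le_exp
  obtain ⟨l, hlω, hla⟩ : ∃ l : ℂ, ω < l.im ∧ a < l.im := by
    obtain ⟨b, hb⟩ := exists_gt (max ω a)
    exact ⟨⟨0, b⟩, max_lt_iff.1 hb⟩
  have hl : ω < |l.im| := hlω.trans_le (le_abs_self _)
  have hinv := isInvFourier_resolventKernel hv hω hl
  exact ⟨Ψ, ⟨K, fun f g hg => hK g _ hg.1 (hΨ f g hg)⟩, l, hl, ⟨_, _, hinv⟩, fun _ => rfl,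
    (hΨ ⟨_, _, hinv⟩ _ hinv).isResolvent hA hCa (hω.trans_lt hlω) hla⟩

namespace IsBoundedSobolevCalculus

variable {hv : StronglyAdmissible v} {hω : 0 ≤ ω} {Ψ : sobolevAlgebra hv hω →ₙₐ[ℂ] (X →L[ℂ] X)}

theorem integral_resolventKernel_mul_eq (hA : (-Complex.I) • A = U.generator)
    (hΨ : IsBoundedSobolevCalculus hv hω A Ψ) {C a : ℝ}
    (hU : ∀ s, ‖U s‖ ≤ C * Real.exp (a * |s|)) (hlω : ω < |l.im|) (hla : a < |l.im|) {x : X}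
    {x' : StrongDual ℂ X} {u : ℝ → ℂ} (hu : ∀ (f : sobolevAlgebra hv hω) (g : ℝ → ℂ),
      IsInvFourier v ω (f : ClosedStrip ω → ℂ) g → x' (Ψ f x) = ∫ s, g s * u s) :
    ∫ s, resolventKernel l s * u s = ∫ s, resolventKernel l s * x' (U s x) := by
  obtain ⟨r, hr, hR⟩ := hΨ.mapsToResolvent hlω
  rw [← hu r _ ((funext hr).symm ▸ isInvFourier_resolventKernel hv hω hlω),
    (hR.isOrbitIntegral hA hU hla x x').2]

theorem ae_eq_orbit (hA : (-Complex.I) • A = U.generator)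
    (hΨ : IsBoundedSobolevCalculus hv hω A Ψ) {x : X} {x' : StrongDual ℂ X} {u : ℝ → ℂ}
    (hu : MemLp (unweighted v ω u) 2 volume) (hform : ∀ (f : sobolevAlgebra hv hω) (g : ℝ → ℂ),
      IsInvFourier v ω (f : ClosedStrip ω → ℂ) g → x' (Ψ f x) = ∫ s, g s * u s) :
    u =ᵐ[volume] fun s => x' (U s x) := by
  obtain ⟨C, a, hCa⟩ := U.exists_norm_le_exp
  have hb : 0 ≤ max ω a := hω.trans (le_max_left _ _)
  have hu_max : MemLp (unweighted v (max ω a) u) 2 volume :=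
    memLp_unweighted_mono (le_max_left _ _) hu
  have horbit_max : MemLp (unweighted v (max ω a) fun s => x' (U s x)) 2 volume :=
    memLp_unweighted_mono (le_max_right _ _) <| hv.memLp_unweighted_of_norm_le (C := ‖x'‖ * C * ‖x‖)
      (x'.continuous.comp (U.continuous x)).aestronglyMeasurable fun s =>
        (x'.le_opNorm_of_le ((U s).le_of_opNorm_le (hCa s) x)).trans_eq (by ring)
  refine Filter.EventuallyEq.symm ((sub_ae_eq_zero _ _).1 ?_)
  refine ae_eq_zero_of_integral_resolventKernel_mul_eq_zero hv hb
    (by rw [unweighted_sub]; exact horbit_max.sub hu_max) fun l hl => ?_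
  have hint := memWeightedL2_resolventKernel hv hb hl
  simp only [Pi.sub_apply, mul_sub]
  rw [integral_sub (hint.integrable_mul hv horbit_max) (hint.integrable_mul hv hu_max), sub_eq_zero,
    hΨ.integral_resolventKernel_mul_eq hA hCa ((le_max_left _ _).trans_lt hl)
      ((le_max_right _ _).trans_lt hl) hform]

theorem memLp_unweighted_orbit (hA : (-Complex.I) • A = U.generator)
    (hΨ : IsBoundedSobolevCalculus hv hω A Ψ) (x : X) (x' : StrongDual ℂ X) :
    MemLp (unweighted v ω fun s => x' (U s x)) 2 volume := by
  obtain ⟨u, hu, hform⟩ := hΨ.exists_density x x'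
  exact hu.ae_eq (unweighted_congr_ae (hΨ.ae_eq_orbit hA hu hform))

theorem isOrbitIntegral (hA : (-Complex.I) • A = U.generator)
    (hΨ : IsBoundedSobolevCalculus hv hω A Ψ) {f : sobolevAlgebra hv hω}
    (hg : IsInvFourier v ω (f : ClosedStrip ω → ℂ) g) : IsOrbitIntegral U g (Ψ f) := by
  refine fun x x' => ⟨hg.1.integrable_mul hv (hΨ.memLp_unweighted_orbit hA x x'), ?_⟩
  obtain ⟨u, hu, hform⟩ := hΨ.exists_density x x'
  rw [hform f g hg]
  exact integral_congr_ae ((Filter.EventuallyEq.refl _ _).mul (hΨ.ae_eq_orbit hA hu hform))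

end IsBoundedSobolevCalculus

end Calculus

end SobolevCalculus

theorem mainTheorem11 {X : Type*} [NormedAddCommGroup X] [NormedSpace ℂ X] [CompleteSpace X]
    (U : SobolevCalculus.C0Group X) (A : X →ₗ.[ℂ] X) (hA : (-Complex.I) • A = U.generator)
    {ω : ℝ} (hω : 0 ≤ ω) {v : ℝ → ℝ} (hv : SobolevCalculus.StronglyAdmissible v) :
    ((∀ (x : X) (x' : StrongDual ℂ X),
        MemLp (fun s : ℝ => ((Real.exp (-ω * |s|) / v s : ℝ) : ℂ) * x' (U s x)) 2 volume) ↔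
      SobolevCalculus.HasBoundedSobolevCalculus hv hω A) ∧
    ∀ Ψ : SobolevCalculus.sobolevAlgebra hv hω →ₙₐ[ℂ] (X →L[ℂ] X),
      SobolevCalculus.IsBoundedSobolevCalculus hv hω A Ψ →
        (∀ l : ℂ, ω < |l.im| → SobolevCalculus.MapsToResolvent hv hω A Ψ l) ∧
        ∀ (f : SobolevCalculus.sobolevAlgebra hv hω) (g : ℝ → ℂ),
          SobolevCalculus.IsInvFourier v ω f g →
            ∀ (x : X) (x' : StrongDual ℂ X),
              Integrable (fun s : ℝ => g s * x' (U s x)) volume ∧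
                x' (Ψ f x) = ∫ s : ℝ, g s * x' (U s x) := by
  refine ⟨⟨SobolevCalculus.hasBoundedSobolevCalculus_of_memLp hA hv hω,
    fun ⟨Ψ, hΨ⟩ => hΨ.memLp_unweighted_orbit hA⟩, fun Ψ hΨ => ⟨fun l hl => ?_, fun f g hg => ?_⟩⟩
  · exact hΨ.mapsToResolvent hl
  · exact hΨ.isOrbitIntegral hA hg
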